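/- Setting. Let $x_{k+1}=Ax_k+w_k$ in $\mathbb{R}^{n}$ and $y_k=Cx_k+v_k$ in $\mathbb{R}^{m}$ ($k\ge 0$), where $w_k\sim N(0,Q)$ with $Q>0$, $v_k\sim N(0,R)$ with $R>0$, and $x_0$ is Gaussian. Let $\gamma_k,\gamma_{e,k}\in\{0,1\}$ be Bernoulli with $\mathbb{P}(\gamma_k=1)=\lambda$ and $\mathbb{P}(\gamma_{e,k}=1)=\lambda_e$ for all $k$; all of $x_0,(w_k),(v_k),(\gamma_k),(\gamma_{e,k})$ are mutually independent. The sensor computes $\hat x^s_{k}=\mathbb{E}[x_k\mid y_0,\dots,y_k]$, and its Kalman filter is in steady state: $\mathbb{E}[(x_k-\hat x^s_k)(x_k-\hat x^s_k)^T\mid y_0,\dots,y_k]=\bar P$ almost surely for all $k\ge 0$. A transmission policy determines the decision $\nu_k\in\{0,1\}$ to transmit $\hat x^s_k$ at time $k$ as a function of the outcomes $\gamma_i,\gamma_{e,i}$, $i<k$ (so it does not depend on the states or the measurements). For $k\ge1$ the packet is received by the remote estimator iff $\nu_k\gamma_k=1$ and by the eavesdropper iff $\nu_k\gamma_{e,k}=1$;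 at time $0$ both receive $\hat x^s_0$. At time $k$ the remote estimator learns $\nu_k$, whether it has received the packet, and $\hat x^s_k$ if it has; let $\mathcal{I}_k$ be all that it has learned up to time $k$, and $$P_{k|k}=\mathbb{E}\big[(x_k-\mathbb{E}[x_k|\mathcal I_k])(x_k-\mathbb{E}[x_k|\mathcal I_k])^T\,\big|\,\mathcal I_k\big].$$ Likewise let $z_{e,k}$ be what the eavesdropper learns at time $k$ ($\nu_k$, whether it has received the packet, and $\hat x^s_k$ if it has). The expected information revealed to the eavesdropper at time $k$ is the conditional mutual information $\mathbb{E}[I_{e,k}]=I(x_k;z_{e,k}\mid z_{e,0},\dots,z_{e,k-1})$, in nats. Theorem. Let $A$ be unstable (some eigenvalue of $A$ has modulus larger than $1$), and let $\lambda_e>0$. Then there is an $\epsilon>0$ that depends only on $\lambda_e,A,Q,\bar P$ such that every transmission policy with $$\limsup_{K\to\infty}\frac1K\sum_{k=1}^K \operatorname{tr}\mathbb{E}[P_{k|k}]<\infty$$ satisfies $$\liminf_{K\to\infty}\frac1K\sum_{k=1}^K\mathbb{E}[I_{e,k}]>\epsilon .$$ -/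

import Mathlib

open MeasureTheory ProbabilityTheory Filter

namespace RemoteEstimation

noncomputable section

/-- Real column vectors of length `n`. -/
abbrev Vec (n : ℕ) : Type := EuclideanSpace ℝ (Fin n)

/-- `A` is unstable: it has a complex eigenvalue of modulus larger than one, in other words its
spectral radius exceeds one. -/
def IsUnstable {n : ℕ} (A : Matrix (Fin n) (Fin n) ℝ) : Prop :=
  ∃ z ∈ spectrum ℂ (A.map ((↑) : ℝ → ℂ)), 1 < ‖z‖

/-- The conditional error covariance `E[(X - E[X|𝓖])(X - E[X|𝓖])ᵀ | 𝓖]` of a random vector `X`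
given a σ-algebra `𝓖`, a random matrix. -/
def condErrCov {n : ℕ} {Ω : Type*} [MeasurableSpace Ω] (μ : Measure Ω)
    (X : Ω → Vec n) (𝓖 : MeasurableSpace Ω) (ω : Ω) : Matrix (Fin n) (Fin n) ℝ :=
  Matrix.of fun i j =>
    (μ[fun ω' => (X ω' - (μ[X | 𝓖]) ω') i * (X ω' - (μ[X | 𝓖]) ω') j | 𝓖]) ω

/-- The conditional mutual information `I(X; Z | Y)` in nats: the Kullback-Leibler divergence of
the joint law of `(Y, X, Z)` from the law under which `Y` has its own law and, given `Y`, the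
variables `X` and `Z` are independent with their own conditional laws given `Y`. -/
def condMutualInfo {Ω α β δ : Type*} [MeasurableSpace Ω] [MeasurableSpace α] [MeasurableSpace β]
    [MeasurableSpace δ] [StandardBorelSpace α] [Nonempty α] [StandardBorelSpace β] [Nonempty β]
    (μ : Measure Ω) [IsFiniteMeasure μ] (X : Ω → α) (Z : Ω → β) (Y : Ω → δ) : ENNReal :=
  InformationTheory.klDiv
    (μ.map fun ω => (Y ω, X ω, Z ω))
    ((μ.map Y) ⊗ₘ ((condDistrib X Y μ) ×ₖ (condDistrib Z Y μ)))

/-- The basic random quantities: the initial state, the process noise, the measurement noise and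
the outcomes (`true` = success) of the estimator's channel and of the eavesdropper's channel. -/
structure Primitives (n m : ℕ) (Ω : Type*) where
  x₀ : Ω → Vec n
  w : ℕ → Ω → Vec n
  v : ℕ → Ω → Vec m
  γ : ℕ → Ω → Bool
  γe : ℕ → Ω → Bool

/-- Index set of the basic random quantities. -/
inductive Source
  | init
  | process (k : ℕ)
  | sensor (k : ℕ)
  | channel (k : ℕ)
  | tap (k : ℕ)

/-- A transmission policy: the decision at time `k` (`true` = transmit) as a function of the
outcomes of both channels at times `0, …, k - 1`. -/
abbrev Policy : Type := (k : ℕ) → (Fin k → Bool × Bool) → Bool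

namespace Primitives

variable {n m : ℕ} {Ω : Type*} [MeasurableSpace Ω]

/-- The σ-algebra generated by one of the basic random quantities. -/
@[reducible] def sigma (s : Primitives n m Ω) : Source → MeasurableSpace Ω
  | .init => MeasurableSpace.comap s.x₀ inferInstance
  | .process k => MeasurableSpace.comap (s.w k) inferInstance
  | .sensor k => MeasurableSpace.comap (s.v k) inferInstance
  | .channel k => MeasurableSpace.comap (s.γ k) inferInstance
  | .tap k => MeasurableSpace.comap (s.γe k) inferInstance

/-- The state process `x (k+1) = A x k + w k`. -/
def state (s : Primitives n m Ω) (A : Matrix (Fin n) (Fin n) ℝ) : ℕ → Ω → Vec n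
  | 0 => s.x₀
  | k + 1 => fun ω => Matrix.toEuclideanLin A (s.state A k ω) + s.w k ω

/-- The measurements `y k = C x k + v k`. -/
def meas (s : Primitives n m Ω) (A : Matrix (Fin n) (Fin n) ℝ) (C : Matrix (Fin m) (Fin n) ℝ)
    (k : ℕ) (ω : Ω) : Vec m :=
  Matrix.toEuclideanLin C (s.state A k ω) + s.v k ω

/-- The σ-algebra generated by `y 0, …, y k`. -/
@[reducible] def sensorInfo (s : Primitives n m Ω) (A : Matrix (Fin n) (Fin n) ℝ)
    (C : Matrix (Fin m) (Fin n) ℝ) (k : ℕ) : MeasurableSpace Ω :=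
  MeasurableSpace.comap (fun ω (i : Fin (k + 1)) => s.meas A C i ω) inferInstance

/-- The sensor's local estimate `E[x k | y 0, …, y k]`. -/
def localEst (s : Primitives n m Ω) (μ : Measure Ω) (A : Matrix (Fin n) (Fin n) ℝ)
    (C : Matrix (Fin m) (Fin n) ℝ) (k : ℕ) : Ω → Vec n :=
  μ[s.state A k | s.sensorInfo A C k]

/-- The transmission decision `ν k`. -/
def tx (s : Primitives n m Ω) (π : Policy) (k : ℕ) (ω : Ω) : Bool :=
  π k fun i => (s.γ i ω, s.γe i ω)

/-- Whether the packet of time `k` arrives over the channel with outcomes `ch`: the sensor has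
to transmit and the channel has to succeed. The packet of time `0` always arrives: this is the
convention that both error covariances start from the sensor's own one. -/
def arrives (s : Primitives n m Ω) (π : Policy) (ch : ℕ → Ω → Bool) (k : ℕ) (ω : Ω) : Bool :=
  if k = 0 then true else s.tx π k ω && ch k ω

/-- What a receiver behind the channel `ch` learns at time `k`: the decision `ν k`, whether the
packet arrived, and the local estimate if it did (zero otherwise). -/
def obs (s : Primitives n m Ω) (μ : Measure Ω) (A : Matrix (Fin n) (Fin n) ℝ)
    (C : Matrix (Fin m) (Fin n) ℝ) (π : Policy) (ch : ℕ → Ω → Bool) (k : ℕ) (ω : Ω) :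
    Bool × Bool × Vec n :=
  (s.tx π k ω, s.arrives π ch k ω, if s.arrives π ch k ω then s.localEst μ A C k ω else 0)

/-- All that a receiver behind the channel `ch` has learned at the times before `k`. -/
def past (s : Primitives n m Ω) (μ : Measure Ω) (A : Matrix (Fin n) (Fin n) ℝ)
    (C : Matrix (Fin m) (Fin n) ℝ) (π : Policy) (ch : ℕ → Ω → Bool) (k : ℕ) (ω : Ω) :
    Fin k → Bool × Bool × Vec n :=
  fun i => s.obs μ A C π ch i ω

/-- The information set of a receiver behind the channel `ch` at time `k`, as a σ-algebra. -/
@[reducible] def info (s : Primitives n m Ω) (μ : Measure Ω) (A : Matrix (Fin n) (Fin n) ℝ)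
    (C : Matrix (Fin m) (Fin n) ℝ) (π : Policy) (ch : ℕ → Ω → Bool) (k : ℕ) :
    MeasurableSpace Ω :=
  MeasurableSpace.comap (s.past μ A C π ch (k + 1)) inferInstance

/-- The error covariance `P_{k|k}` of the remote estimator, a random matrix. -/
def remoteErrCov (s : Primitives n m Ω) (μ : Measure Ω) (A : Matrix (Fin n) (Fin n) ℝ)
    (C : Matrix (Fin m) (Fin n) ℝ) (π : Policy) (k : ℕ) :
    Ω → Matrix (Fin n) (Fin n) ℝ :=
  condErrCov μ (s.state A k) (s.info μ A C π s.γ k)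

/-- The matrix `E[P_{k|k}]`. -/
def meanRemoteErrCov (s : Primitives n m Ω) (μ : Measure Ω) (A : Matrix (Fin n) (Fin n) ℝ)
    (C : Matrix (Fin m) (Fin n) ℝ) (π : Policy) (k : ℕ) : Matrix (Fin n) (Fin n) ℝ :=
  Matrix.of fun i j => ∫ ω, s.remoteErrCov μ A C π k ω i j ∂μ

/-- The expected information `E[I_{e,k}]` about the state `x k` that is revealed to the
eavesdropper at time `k`: the conditional mutual information between `x k` and what the
eavesdropper learns at time `k`, given all that it has learned before. -/
def revealedInfo (s : Primitives n m Ω) (μ : Measure Ω) [IsFiniteMeasure μ]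
    (A : Matrix (Fin n) (Fin n) ℝ) (C : Matrix (Fin m) (Fin n) ℝ) (π : Policy) (k : ℕ) :
    ENNReal :=
  condMutualInfo μ (s.state A k) (s.obs μ A C π s.γe k) (s.past μ A C π s.γe k)

/-- The standing assumptions on the system: mutually independent Gaussian initial state, process
noise with covariance `Q`, measurement noise with covariance `R` and Bernoulli channel outcomes
with success probabilities `lam` and `lamE`; the sensor's Kalman filter runs in steady state,
its error covariance being `Pbar` at all times. -/
structure IsModel (s : Primitives n m Ω) (μ : Measure Ω) (A : Matrix (Fin n) (Fin n) ℝ)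
    (C : Matrix (Fin m) (Fin n) ℝ) (Q : Matrix (Fin n) (Fin n) ℝ)
    (R : Matrix (Fin m) (Fin m) ℝ) (Pbar : Matrix (Fin n) (Fin n) ℝ) (lam lamE : ℝ) :
    Prop where
  measurable_init : Measurable s.x₀
  measurable_process : ∀ k, Measurable (s.w k)
  measurable_sensor : ∀ k, Measurable (s.v k)
  measurable_channel : ∀ k, Measurable (s.γ k)
  measurable_tap : ∀ k, Measurable (s.γe k)
  independent : iIndep s.sigma μ
  law_init : IsGaussian (μ.map s.x₀)
  law_process : ∀ k, μ.map (s.w k) = multivariateGaussian 0 Q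
  law_sensor : ∀ k, μ.map (s.v k) = multivariateGaussian 0 R
  law_channel : ∀ k, μ.real {ω | s.γ k ω = true} = lam
  law_tap : ∀ k, μ.real {ω | s.γe k ω = true} = lamE
  steady_state : ∀ k, ∀ᵐ ω ∂μ, condErrCov μ (s.state A k) (s.sensorInfo A C k) ω = Pbar

end Primitives

end

end RemoteEstimation

/-! A packet read by the eavesdropper replaces a prediction of some age t ≥ 1 by the sensor's
estimate. Let a + ib be a left eigenvector of A for an eigenvalue α + iβ of squared modulus ρ = α² +
β² > 1. The prediction error variances in the directions a and b have a sum that is multiplied by ρ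
in each step and also gains a positive amount from Q. Hence in one of the two directions the
variance at age t exceeds ρ^t times the variance of the sensor's own error (`exists_direction`).
Comparing Gaussian laws in that single direction shows that the packet reveals at least t · ½ log ρ
nats (`ofReal_le_condMutualInfo`): information is linear in the gap that a reception closes.

Such gaps telescope. The eavesdropper's last reception is never later than the last transmission,
and its channel outcome is independent of the decision taken at the same time. So the expected gap
it closes is at least λ_e times the expected increment of the time of the last transmission
(`mul_integral_lastTx_sub_le`), and the information up to time K totals at least ½ log ρ · λ_e ·
E[`lastTx` K] (`ofReal_le_sum_revealedInfo`).

It remains to see that E[`lastTx` K] ≥ K/2 for large K. The remote error at time K is at least a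
constant times E[(K - `lastTx` K)²] (`integral_sq_le_trace`). Bounded averages force the single
trace at time K to be O(K), so the root mean square gap is O(√K), negligible against K. Quadratic
growth of the prediction variance is enough for this half. -/

namespace RemoteEstimation

/-! ### Divergence bound by test functions, and independence of σ-algebras. -/

section Generic

open InformationTheory Real

/-- Lower bound on the Kullback-Leibler divergence by a test function with exponential moment at
most one (Donsker-Varadhan). -/
lemma ofReal_integral_le_klDiv {α : Type*} [MeasurableSpace α] {P Q : Measure α}
    [IsProbabilityMeasure P] [IsProbabilityMeasure Q] {φ : α → ℝ} (hφ : Measurable φ)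
    (hint : Integrable φ P) (hexp : ∫⁻ x, ENNReal.ofReal (exp (φ x)) ∂Q ≤ 1) :
    ENNReal.ofReal (∫ x, φ x ∂P) ≤ klDiv P Q := by
  by_cases hPQ : P ≪ Q
  swap; · simp [hPQ]
  by_cases hllr : Integrable (llr P Q) P
  swap; · simp [hllr]
  have hexpint : Integrable (fun x => exp (φ x)) Q := by
    refine ⟨(measurable_exp.comp hφ).aestronglyMeasurable, ?_⟩
    rw [hasFiniteIntegral_iff_ofReal (ae_of_all _ fun x => (exp_pos _).le)]
    exact hexp.trans_lt ENNReal.one_lt_top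
  have hle : ∫ x, exp (φ x) ∂Q ≤ 1 := by
    rw [integral_eq_lintegral_of_nonneg_ae (ae_of_all _ fun x => (exp_pos _).le)
      hexpint.aestronglyMeasurable]
    exact ENNReal.toReal_le_of_le_ofReal zero_le_one (by simpa using hexp)
  have hpos : 0 < ∫ x, exp (φ x) ∂Q := integral_exp_pos hexpint
  have : IsProbabilityMeasure (Q.tilted φ) := isProbabilityMeasure_tilted hexpint
  have hac : P ≪ Q.tilted φ := hPQ.trans (absolutelyContinuous_tilted hexpint)
  -- The divergence of P from the tilted measure is nonnegative; expanded, this reads E_P[φ] - log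
  -- E_Q[exp φ] ≤ KL(P, Q), and the logarithm is at most zero.
  have h := integral_llr_add_mul_log_nonneg hac
    (integrable_llr_tilted_right hPQ hint hllr hexpint)
  rw [integral_llr_tilted_right hPQ hint hexpint hllr] at h
  have hlog := log_nonpos hpos.le hle
  simp only [measureReal_def, measure_univ, ENNReal.toReal_one, log_one] at h
  rw [klDiv_of_ac_of_integrable hPQ hllr]
  refine ENNReal.ofReal_le_ofReal ?_
  simp only [measureReal_def, measure_univ, ENNReal.toReal_one]
  linarith

/-- Intersections a ∩ b form a π-system generating `m₂ ⊔ m₃`, and the measure of s ∩ a ∩ b factors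
by splitting off b and then a. -/
lemma indep_sup_right_of_indep_sup_left {Ω : Type*} {m₁ m₂ m₃ m0 : MeasurableSpace Ω}
    {μ : Measure Ω} [IsProbabilityMeasure μ] (h₁ : m₁ ≤ m0) (h₂ : m₂ ≤ m0) (h₃ : m₃ ≤ m0)
    (h : Indep m₁ m₂ μ) (h' : Indep (m₁ ⊔ m₂) m₃ μ) : Indep m₁ (m₂ ⊔ m₃) μ := by
  have hpi : IsPiSystem
      (Set.image2 (· ∩ ·) {s | MeasurableSet[m₂] s} {s | MeasurableSet[m₃] s}) := by
    rintro _ ⟨a, ha, b, hb, rfl⟩ _ ⟨c, hc, d, hd, rfl⟩ -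
    exact ⟨a ∩ c, MeasurableSet.inter ha hc, b ∩ d, MeasurableSet.inter hb hd,
      Set.inter_inter_inter_comm ..⟩
  refine IndepSets.indep h₁ (sup_le h₂ h₃) (@MeasurableSpace.isPiSystem_measurableSet _ m₁) hpi
    (@MeasurableSpace.generateFrom_measurableSet _ m₁).symm ?_ ?_
  · refine le_antisymm (sup_le ?_ ?_) (MeasurableSpace.generateFrom_le ?_)
    · exact fun s hs => MeasurableSpace.measurableSet_generateFrom
        ⟨s, hs, Set.univ, MeasurableSet.univ, Set.inter_univ s⟩
    · exact fun s hs => MeasurableSpace.measurableSet_generateFrom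
        ⟨Set.univ, MeasurableSet.univ, s, hs, Set.univ_inter s⟩
    · rintro _ ⟨a, ha, b, hb, rfl⟩
      exact MeasurableSet.inter (le_sup_left (a := m₂) (b := m₃) _ ha)
        (le_sup_right (a := m₂) (b := m₃) _ hb)
  · rw [IndepSets_iff]
    rintro s _ hs ⟨a, ha, b, hb, rfl⟩
    rw [Indep_iff] at h h'
    have e₁ := h' (s ∩ a) b (MeasurableSet.inter (le_sup_left (a := m₁) (b := m₂) _ hs)
      (le_sup_right (a := m₁) (b := m₂) _ ha)) hb
    have e₂ := h' a b (le_sup_right (a := m₁) (b := m₂) _ ha) hb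
    have e₃ := h s a hs ha
    simp only at *
    rw [← Set.inter_assoc, e₁, e₂, e₃, mul_assoc]

/-- The joint law of T and e is a product, so e can be integrated out with T frozen. This form of
Fubini replaces conditioning on `G`. -/
lemma lintegral_comp_of_indep {Ω α β : Type*} [MeasurableSpace α] [MeasurableSpace β]
    {G m0 : MeasurableSpace Ω} {μ : Measure Ω} [IsProbabilityMeasure μ] (hG : G ≤ m0)
    {e : Ω → β} (he : Measurable e) {T : Ω → α} (hT : Measurable[G] T)
    (hind : Indep (MeasurableSpace.comap e inferInstance) G μ)
    {F : α × β → ENNReal} (hF : Measurable F) :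
    ∫⁻ ω, F (T ω, e ω) ∂μ = ∫⁻ ω, ∫⁻ r, F (T ω, r) ∂(μ.map e) ∂μ := by
  have hT' : Measurable T := hT.mono hG le_rfl
  have hTe : IndepFun T e μ := by
    rw [IndepFun_iff_Indep]
    exact (indep_of_indep_of_le_right hind hT.comap_le).symm
  have := (indepFun_iff_map_prod_eq_prod_map_map hT'.aemeasurable he.aemeasurable).1 hTe
  have : IsProbabilityMeasure (μ.map e) := Measure.isProbabilityMeasure_map he.aemeasurable
  rw [← lintegral_map (f := F) (g := fun ω => (T ω, e ω)) hF (hT'.prodMk he),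
    ‹μ.map _ = _›, lintegral_prod _ hF.aemeasurable,
    lintegral_map (hF.lintegral_prod_right') hT']

end Generic

/-! ### Linear regression of jointly Gaussian vectors. -/

section Regression

variable {Ω : Type*} [MeasurableSpace Ω] {μ : Measure Ω} [IsProbabilityMeasure μ]
  {F : Type*} [NormedAddCommGroup F] [NormedSpace ℝ F] [FiniteDimensional ℝ F]

/-- The best affine approximation in mean square. -/
lemma exists_affine_regression {Z : Ω → ℝ} {Y : Ω → F} (hZ : MemLp Z 2 μ) (hY : MemLp Y 2 μ) :
    ∃ (c : ℝ) (L : StrongDual ℝ F), ∀ (c' : ℝ) (L' : StrongDual ℝ F),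
      ∫ ω, (Z ω - (c + L (Y ω))) * (c' + L' (Y ω)) ∂μ = 0 := by
  have hmem : ∀ p : ℝ × StrongDual ℝ F, MemLp (fun ω => p.1 + p.2 (Y ω)) 2 μ := fun p =>
    (memLp_const p.1).add (hY.continuousLinearMap_comp p.2)
  let T : ℝ × StrongDual ℝ F →ₗ[ℝ] Lp ℝ 2 μ :=
    { toFun := fun p => (hmem p).toLp _
      map_add' := fun p q => by
        rw [← MemLp.toLp_add]
        congr 1
        ext ω
        simp
        ring
      map_smul' := fun r p => by
        rw [RingHom.id_apply, ← MemLp.toLp_const_smul]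
        congr 1
        ext ω
        simp
        ring }
  -- Affine functions of Y span a finite-dimensional subspace of L², so the orthogonal projection
  -- exists; p holds its coefficients.
  obtain ⟨p, hp⟩ : (LinearMap.range T).starProjection (hZ.toLp Z) ∈ LinearMap.range T :=
    Submodule.starProjection_apply_mem _ _
  refine ⟨p.1, p.2, fun c' L' => ?_⟩
  have h0 := Submodule.starProjection_inner_eq_zero (K := LinearMap.range T) (hZ.toLp Z) (T (c', L'))
    ⟨_, rfl⟩
  rw [← hp, L2.inner_def] at h0
  rw [← h0]
  refine integral_congr_ae ?_
  filter_upwards [Lp.coeFn_sub (hZ.toLp Z) (T p), hZ.coeFn_toLp, (hmem p).coeFn_toLp,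
    (hmem (c', L')).coeFn_toLp] with ω h1 h2 h3 h4
  have h3' : (T p : Ω → ℝ) ω = p.1 + p.2 (Y ω) := h3
  have h4' : (T (c', L') : Ω → ℝ) ω = c' + L' (Y ω) := h4
  rw [h1, h4', Pi.sub_apply, h2, h3']
  simp [mul_comm]

/-- For jointly Gaussian vectors the error of the conditional expectation is Gaussian and
independent of the conditioning vector. -/
lemma gaussian_regression [MeasurableSpace F] [BorelSpace F] {n : ℕ} {X : Ω → Vec n}
    {Y : Ω → F} (hYm : Measurable Y)
    (hXY : HasGaussianLaw (fun ω => (X ω, Y ω)) μ) :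
    HasGaussianLaw (fun ω => X ω - (μ[X | MeasurableSpace.comap Y inferInstance]) ω) μ ∧
    IndepFun (fun ω => X ω - (μ[X | MeasurableSpace.comap Y inferInstance]) ω) Y μ := by
  have : CompleteSpace F := FiniteDimensional.complete ℝ F
  have hX2 : MemLp X 2 μ := hXY.fst.memLp_two
  have hY2 : MemLp Y 2 μ := hXY.snd.memLp_two
  have hXi : ∀ i, MemLp (fun ω => X ω i) 2 μ := fun i =>
    hX2.continuousLinearMap_comp (EuclideanSpace.proj i : Vec n →L[ℝ] ℝ)
  choose c L hL using fun i => exists_affine_regression (hXi i) hY2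
  let Λ : F →L[ℝ] Vec n := (EuclideanSpace.equiv (Fin n) ℝ).symm.toContinuousLinearMap.comp
    (ContinuousLinearMap.pi L)
  let c₀ : Vec n := WithLp.toLp 2 c
  let D : Ω → Vec n := fun ω => X ω - Λ (Y ω)
  have hDY : HasGaussianLaw (fun ω => (D ω, Y ω)) μ :=
    hXY.map_fun (((ContinuousLinearMap.fst ℝ (Vec n) F) -
      Λ.comp (ContinuousLinearMap.snd ℝ (Vec n) F)).prod (ContinuousLinearMap.snd ℝ (Vec n) F))
  have hD2 : MemLp D 2 μ := hDY.fst.memLp_two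
  have hDi : ∀ i ω, D ω i = X ω i - L i (Y ω) := fun i ω => by
    simp [D, Λ]
  have hmeanD : ∀ i, ∫ ω, D ω i ∂μ = c i := fun i => by
    have h := hL i 1 0
    have hLi : Integrable (fun ω => L i (Y ω)) μ :=
      (hY2.continuousLinearMap_comp (L i)).integrable one_le_two
    have hXint : Integrable (fun ω => X ω i) μ := (hXi i).integrable one_le_two
    simp only [_root_.zero_apply, add_zero, mul_one] at h
    rw [integral_sub hXint (g := fun ω => c i + L i (Y ω)) ((integrable_const _).add hLi),
      integral_add (integrable_const _) hLi] at h
    simp only [hDi]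
    rw [integral_sub hXint hLi]
    simp at h
    linarith
  have hDint : Integrable D μ := hD2.integrable one_le_two
  have hD_mean : ∫ ω, D ω ∂μ = c₀ := by
    ext i
    refine Eq.trans ?_ (hmeanD i)
    exact ((EuclideanSpace.proj i : Vec n →L[ℝ] ℝ).integral_comp_comm hDint).symm
  have hind : IndepFun D Y μ := by
    -- For a jointly Gaussian pair, zero covariance is independence; the covariances vanish by
    -- orthogonality of the residual to linear functions of Y.
    refine hDY.indepFun_of_covariance_strongDual fun L₁ L₂ => ?_
    have h1 : (L₁ ∘ D) = fun ω => ∑ i, L₁ (EuclideanSpace.single i 1) * D ω i := by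
      ext ω
      have : D ω = ∑ i, D ω i • EuclideanSpace.single i (1 : ℝ) := by
        ext j; simp [Finset.sum_apply, Pi.single_apply]
      simp only [Function.comp]
      conv_lhs => rw [this]
      simp [mul_comm]
    have hDi2 : ∀ i, MemLp (fun ω => D ω i) 2 μ := fun i =>
      hD2.continuousLinearMap_comp (EuclideanSpace.proj i : Vec n →L[ℝ] ℝ)
    have hL2 : MemLp (L₂ ∘ Y) 2 μ := hY2.continuousLinearMap_comp L₂
    rw [h1, covariance_fun_sum_left (fun i => (hDi2 i).const_mul _) hL2]
    refine Finset.sum_eq_zero fun i _ => ?_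
    rw [covariance_const_mul_left]
    refine mul_eq_zero_of_right _ ?_
    rw [covariance_eq_sub (hDi2 i) hL2, hmeanD i]
    have h := hL i 0 L₂
    have hprod : Integrable (fun ω => D ω i * L₂ (Y ω)) μ := (hDi2 i).integrable_mul hL2
    have hLint : Integrable (fun ω => c i * L₂ (Y ω)) μ :=
      (hL2.integrable one_le_two).const_mul _
    have h' : ∫ ω, (D ω i * L₂ (Y ω) - c i * L₂ (Y ω)) ∂μ = 0 := by
      rw [← h]; congr 1; ext ω; rw [hDi]; ring
    rw [integral_sub hprod hLint, integral_const_mul] at h'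
    simpa using h'
  have hle : MeasurableSpace.comap Y inferInstance ≤ (inferInstance : MeasurableSpace Ω) :=
    hYm.comap_le
  have hDm : AEStronglyMeasurable D μ := hDint.aestronglyMeasurable
  have hcD : μ[D | MeasurableSpace.comap Y inferInstance] =ᵐ[μ] fun _ => c₀ := by
    obtain ⟨D', hD'm, hDD'⟩ := hDm
    have hind' : IndepFun D' Y μ := hind.congr hDD' EventuallyEq.rfl
    refine (condExp_congr_ae hDD').trans ?_
    rw [← hD_mean, integral_congr_ae hDD']
    exact condExp_indep_eq hD'm.measurable.comap_le hle
      (comap_measurable D').stronglyMeasurable hind'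
  have hΛint : Integrable (fun ω => Λ (Y ω)) μ :=
    Λ.integrable_comp (hY2.integrable one_le_two)
  have hcX : μ[X | MeasurableSpace.comap Y inferInstance] =ᵐ[μ] fun ω => c₀ + Λ (Y ω) := by
    have hX : X = D + fun ω => Λ (Y ω) := by ext1 ω; simp [D]
    have h1 := condExp_add hDint hΛint (MeasurableSpace.comap Y inferInstance)
    have h2 : μ[fun ω => Λ (Y ω) | MeasurableSpace.comap Y inferInstance] = fun ω => Λ (Y ω) :=
      condExp_of_stronglyMeasurable hle
        (Λ.continuous.measurable.comp (comap_measurable Y)).stronglyMeasurable hΛint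
    rw [← hX, h2] at h1
    filter_upwards [h1, hcD] with ω h3 h4
    rw [h3, Pi.add_apply, h4]
  have hae : (fun ω => D ω - c₀) =ᵐ[μ]
      fun ω => X ω - (μ[X | MeasurableSpace.comap Y inferInstance]) ω := by
    filter_upwards [hcX] with ω h
    rw [h]
    simp only [D]
    abel
  constructor
  · refine HasGaussianLaw.congr ?_ hae
    have := hDY.fst
    have h2 : HasGaussianLaw (fun _ : Ω => c₀) μ := ⟨by
      rw [Measure.map_const, measure_univ, one_smul]; infer_instance⟩
    exact (IndepFun.hasGaussianLaw this h2 (indepFun_const_right _ _)).fun_sub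
  · exact (hind.comp (φ := fun d => d - c₀) (measurable_id.sub_const _) measurable_id).congr hae
      EventuallyEq.rfl

end Regression

/-! ### Quadratic forms and directional prediction variances. -/

/-- The quadratic form `uᵀ M u`. -/
noncomputable def quadForm {n : ℕ} (M : Matrix (Fin n) (Fin n) ℝ) (u : Vec n) : ℝ :=
  ∑ i, ∑ j, u i * u j * M i j

lemma quadForm_eq_dotProduct {n : ℕ} (M : Matrix (Fin n) (Fin n) ℝ) (u : Vec n) :
    quadForm M u = dotProduct u.ofLp (M.mulVec u.ofLp) := by
  simp only [quadForm, dotProduct, Matrix.mulVec, Finset.mul_sum]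
  exact Finset.sum_congr rfl fun i _ => Finset.sum_congr rfl fun j _ => by ring

/-- The variance in direction `u` of the error of the `t`-step prediction, if the initial error
covariance is `P`. -/
noncomputable def predVar {n : ℕ} (A Q P : Matrix (Fin n) (Fin n) ℝ) : ℕ → Vec n → ℝ
  | 0, u => quadForm P u
  | t + 1, u => predVar A Q P t (Matrix.toEuclideanLin A.transpose u) + quadForm Q u

lemma inner_toEuclideanLin {n : ℕ} (A : Matrix (Fin n) (Fin n) ℝ) (u x : Vec n) :
    inner ℝ u (Matrix.toEuclideanLin A x) =
      inner ℝ (Matrix.toEuclideanLin A.transpose u) x := by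
  have := Matrix.toEuclideanLin_conjTranspose_eq_adjoint (𝕜 := ℝ) A
  rw [Matrix.conjTranspose_eq_transpose_of_trivial] at this
  rw [this, LinearMap.adjoint_inner_left]

lemma measurable_toEuclideanLin {n m : ℕ} (A : Matrix (Fin m) (Fin n) ℝ) :
    Measurable (Matrix.toEuclideanLin A) :=
  (Matrix.toEuclideanLin A).continuous_of_finiteDimensional.measurable

/-! ### Linear maps that adjoin a new state and measurement. -/

section GaussianStep

variable {n m k : ℕ} {Ω : Type*} [MeasurableSpace Ω] {μ : Measure Ω}

lemma gaussian_initial_meas (C : Matrix (Fin m) (Fin n) ℝ) {X : Ω → Vec n} {V : Ω → Vec m}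
    (hg : HasGaussianLaw (fun ω => (X ω, V ω)) μ) :
    HasGaussianLaw (fun ω => (X ω, fun _ : Fin (0 + 1) => Matrix.toEuclideanLin C (X ω) + V ω))
      μ := by
  let T : Vec n × Vec m →ₗ[ℝ] Vec n × (Fin (0 + 1) → Vec m) :=
    { toFun := fun p => (p.1, fun _ => Matrix.toEuclideanLin C p.1 + p.2)
      map_add' := fun p q => by
        refine Prod.ext rfl (funext fun i => ?_)
        simp only [Prod.fst_add, Prod.snd_add, map_add, Pi.add_apply]
        abel
      map_smul' := fun r p => by
        refine Prod.ext rfl (funext fun i => ?_)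
        simp }
  exact hg.map_fun T.toContinuousLinearMap

lemma gaussian_step_meas (A : Matrix (Fin n) (Fin n) ℝ) (C : Matrix (Fin m) (Fin n) ℝ)
    {X W : Ω → Vec n} {Y : Ω → Fin (k + 1) → Vec m} {V : Ω → Vec m}
    (hg : HasGaussianLaw (fun ω => (((X ω, Y ω), W ω), V ω)) μ) :
    HasGaussianLaw (fun ω => (Matrix.toEuclideanLin A (X ω) + W ω, fun i : Fin (k + 1 + 1) =>
      if hi : (i : ℕ) < k + 1 then Y ω ⟨i, hi⟩ else
        Matrix.toEuclideanLin C (Matrix.toEuclideanLin A (X ω) + W ω) + V ω)) μ := by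
  let T : ((Vec n × (Fin (k + 1) → Vec m)) × Vec n) × Vec m →ₗ[ℝ]
      Vec n × (Fin (k + 1 + 1) → Vec m) :=
    { toFun := fun p => (Matrix.toEuclideanLin A p.1.1.1 + p.1.2, fun i =>
        if hi : (i : ℕ) < k + 1 then p.1.1.2 ⟨i, hi⟩ else
          Matrix.toEuclideanLin C (Matrix.toEuclideanLin A p.1.1.1 + p.1.2) + p.2)
      map_add' := fun p q => by
        refine Prod.ext ?_ (funext fun i => ?_)
        · simp only [Prod.fst_add, Prod.snd_add, map_add]
          abel
        · by_cases hi : (i : ℕ) < k + 1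
          · simp only [Prod.fst_add, Prod.snd_add, Pi.add_apply, dif_pos hi]
          · simp only [hi, dite_false, Prod.fst_add, Prod.snd_add, map_add, Pi.add_apply]
            abel
      map_smul' := fun r p => by
        refine Prod.ext ?_ (funext fun i => ?_)
        · simp
        · by_cases hi : (i : ℕ) < k + 1
          · simp only [Prod.smul_fst, Prod.smul_snd, Pi.smul_apply, RingHom.id_apply, dif_pos hi]
          · simp only [Prod.smul_fst, Prod.smul_snd, Pi.smul_apply, RingHom.id_apply, dif_neg hi,
              map_add, map_smul, smul_add] }
  exact hg.map_fun T.toContinuousLinearMap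

end GaussianStep

/-! ### Prediction errors: measurability, independence and Gaussian laws. -/

namespace Primitives

variable {n m : ℕ} {Ω : Type*} [mΩ : MeasurableSpace Ω]

/-- The σ-algebra generated by a family of the basic random quantities. -/
@[reducible] def sigmaOn (s : Primitives n m Ω) (S : Set Source) : MeasurableSpace Ω :=
  ⨆ i ∈ S, s.sigma i

omit mΩ in
lemma sigmaOn_mono (s : Primitives n m Ω) {S T : Set Source} (h : S ⊆ T) :
    s.sigmaOn S ≤ s.sigmaOn T :=
  biSup_mono h

omit mΩ in
lemma sigma_le_sigmaOn (s : Primitives n m Ω) {S : Set Source} {i : Source} (h : i ∈ S) :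
    s.sigma i ≤ s.sigmaOn S :=
  le_biSup s.sigma h

/-- The sources of the outcomes of both channels. -/
def channelSources : Set Source := {i | ∃ k, i = .channel k ∨ i = .tap k}

/-- The sources of the outcomes of both channels before time `k`. -/
def channelSourcesBefore (k : ℕ) : Set Source :=
  {i | ∃ l < k, i = .channel l ∨ i = .tap l}

/-- The sources of the states and the measurements up to time `k`. -/
def systemSources (k : ℕ) : Set Source :=
  {i | i = .init ∨ (∃ l < k, i = .process l) ∨ ∃ l ≤ k, i = .sensor l}

lemma systemSources_mono : Monotone systemSources := by
  rintro j k hjk i (h | ⟨l, hl, h⟩ | ⟨l, hl, h⟩)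
  · exact Or.inl h
  · exact Or.inr (Or.inl ⟨l, hl.trans_le hjk, h⟩)
  · exact Or.inr (Or.inr ⟨l, hl.trans hjk, h⟩)

/-- The error at time `j + t` of the prediction from the local estimate of time `j`. -/
noncomputable def predErr (s : Primitives n m Ω) (μ : Measure Ω) (A : Matrix (Fin n) (Fin n) ℝ)
    (C : Matrix (Fin m) (Fin n) ℝ) (j t : ℕ) (ω : Ω) : Vec n :=
  s.state A (j + t) ω - ((Matrix.toEuclideanLin A) ^ t) (s.localEst μ A C j ω)

/-- The measurements up to time `j` and the outcomes of both channels. -/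
@[reducible] noncomputable def fullInfo (s : Primitives n m Ω) (A : Matrix (Fin n) (Fin n) ℝ)
    (C : Matrix (Fin m) (Fin n) ℝ) (j : ℕ) : MeasurableSpace Ω :=
  s.sensorInfo A C j ⊔ s.sigmaOn channelSources

lemma predErr_succ (s : Primitives n m Ω) (μ : Measure Ω) (A : Matrix (Fin n) (Fin n) ℝ)
    (C : Matrix (Fin m) (Fin n) ℝ) (j t : ℕ) (ω : Ω) :
    s.predErr μ A C j (t + 1) ω =
      Matrix.toEuclideanLin A (s.predErr μ A C j t ω) + s.w (j + t) ω := by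
  change Matrix.toEuclideanLin A (s.state A (j + t) ω) + s.w (j + t) ω - _ = _
  simp only [predErr, map_sub, pow_succ', Module.End.mul_apply]
  abel

omit mΩ in
lemma measurable_state_sigmaOn (s : Primitives n m Ω) (A : Matrix (Fin n) (Fin n) ℝ) (k : ℕ) :
    Measurable[s.sigmaOn (systemSources k)] (s.state A k) := by
  induction k with
  | zero =>
    exact (comap_measurable s.x₀).mono (s.sigma_le_sigmaOn (i := .init) (Or.inl rfl)) le_rfl
  | succ k ih =>
    refine Measurable.add (((measurable_toEuclideanLin A).comp
      (ih.mono (s.sigmaOn_mono (systemSources_mono k.le_succ)) le_rfl))) ?_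
    exact (comap_measurable (s.w k)).mono
      (s.sigma_le_sigmaOn (i := .process k) (Or.inr (Or.inl ⟨k, k.lt_succ_self, rfl⟩))) le_rfl

omit mΩ in
lemma measurable_meas_sigmaOn (s : Primitives n m Ω) (A : Matrix (Fin n) (Fin n) ℝ)
    (C : Matrix (Fin m) (Fin n) ℝ) (k : ℕ) :
    Measurable[s.sigmaOn (systemSources k)] (s.meas A C k) := by
  refine Measurable.add ((measurable_toEuclideanLin C).comp (s.measurable_state_sigmaOn A k)) ?_
  exact (comap_measurable (s.v k)).mono
    (s.sigma_le_sigmaOn (i := .sensor k) (Or.inr (Or.inr ⟨k, le_rfl, rfl⟩))) le_rfl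

omit mΩ in
lemma measurable_meas_sensorInfo (s : Primitives n m Ω) (A : Matrix (Fin n) (Fin n) ℝ)
    (C : Matrix (Fin m) (Fin n) ℝ) {i k : ℕ} (h : i ≤ k) :
    Measurable[s.sensorInfo A C k] (s.meas A C i) :=
  (measurable_pi_apply (⟨i, Nat.lt_succ_of_le h⟩ : Fin (k + 1))).comp
    (comap_measurable fun ω (i : Fin (k + 1)) => s.meas A C i ω)

omit mΩ in
lemma sensorInfo_le_sigmaOn (s : Primitives n m Ω) (A : Matrix (Fin n) (Fin n) ℝ)
    (C : Matrix (Fin m) (Fin n) ℝ) (k : ℕ) :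
    s.sensorInfo A C k ≤ s.sigmaOn (systemSources k) := by
  refine Measurable.comap_le ?_
  refine @measurable_pi_lambda _ _ _ (s.sigmaOn (systemSources k)) _ _ fun i => ?_
  exact (s.measurable_meas_sigmaOn A C i).mono
    (s.sigmaOn_mono (systemSources_mono (Nat.le_of_lt_succ i.2))) le_rfl

omit mΩ in
lemma sensorInfo_mono (s : Primitives n m Ω) (A : Matrix (Fin n) (Fin n) ℝ)
    (C : Matrix (Fin m) (Fin n) ℝ) : Monotone (s.sensorInfo A C) := by
  intro j k hjk
  refine Measurable.comap_le ?_
  refine @measurable_pi_lambda _ _ _ (s.sensorInfo A C k) _ _ fun i => ?_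
  exact s.measurable_meas_sensorInfo A C ((Nat.le_of_lt_succ i.2).trans hjk)

lemma measurable_localEst_sensorInfo (s : Primitives n m Ω) (μ : Measure Ω)
    (A : Matrix (Fin n) (Fin n) ℝ) (C : Matrix (Fin m) (Fin n) ℝ) (k : ℕ) :
    Measurable[s.sensorInfo A C k] (s.localEst μ A C k) :=
  stronglyMeasurable_condExp.measurable

namespace IsModel

variable {s : Primitives n m Ω} {μ : Measure Ω} [IsProbabilityMeasure μ]
  {A : Matrix (Fin n) (Fin n) ℝ} {C : Matrix (Fin m) (Fin n) ℝ} {Q : Matrix (Fin n) (Fin n) ℝ}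
  {R : Matrix (Fin m) (Fin m) ℝ} {Pbar : Matrix (Fin n) (Fin n) ℝ} {lam lamE : ℝ}

section
omit [IsProbabilityMeasure μ]

lemma sigma_le (h : s.IsModel μ A C Q R Pbar lam lamE) (i : Source) : s.sigma i ≤ mΩ := by
  cases i with
  | init => exact h.measurable_init.comap_le
  | process k => exact (h.measurable_process k).comap_le
  | sensor k => exact (h.measurable_sensor k).comap_le
  | channel k => exact (h.measurable_channel k).comap_le
  | tap k => exact (h.measurable_tap k).comap_le

lemma sigmaOn_le (h : s.IsModel μ A C Q R Pbar lam lamE) (S : Set Source) : s.sigmaOn S ≤ mΩ :=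
  iSup₂_le fun i _ => h.sigma_le i

lemma indep_sigmaOn (h : s.IsModel μ A C Q R Pbar lam lamE) {S T : Set Source}
    (hST : Disjoint S T) : Indep (s.sigmaOn S) (s.sigmaOn T) μ :=
  indep_iSup_of_disjoint h.sigma_le h.independent hST

lemma sensorInfo_le (h : s.IsModel μ A C Q R Pbar lam lamE) (k : ℕ) :
    s.sensorInfo A C k ≤ mΩ :=
  (s.sensorInfo_le_sigmaOn A C k).trans (h.sigmaOn_le _)

lemma fullInfo_le (h : s.IsModel μ A C Q R Pbar lam lamE) (k : ℕ) :
    s.fullInfo A C k ≤ mΩ :=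
  sup_le (h.sensorInfo_le k) (h.sigmaOn_le _)

lemma measurable_state (h : s.IsModel μ A C Q R Pbar lam lamE) (k : ℕ) :
    Measurable (s.state A k) :=
  (s.measurable_state_sigmaOn A k).mono (h.sigmaOn_le _) le_rfl

lemma measurable_localEst (h : s.IsModel μ A C Q R Pbar lam lamE) (k : ℕ) :
    Measurable (s.localEst μ A C k) :=
  (s.measurable_localEst_sensorInfo μ A C k).mono (h.sensorInfo_le k) le_rfl

lemma measurable_predErr_sigmaOn (_ : s.IsModel μ A C Q R Pbar lam lamE) (j t : ℕ) :
    Measurable[s.sigmaOn (systemSources (j + t))] (s.predErr μ A C j t) := by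
  refine Measurable.sub (s.measurable_state_sigmaOn A (j + t)) ?_
  refine ((Matrix.toEuclideanLin A) ^ t).continuous_of_finiteDimensional.measurable.comp ?_
  exact (s.measurable_localEst_sensorInfo μ A C j).mono ((s.sensorInfo_le_sigmaOn A C j).trans
    (s.sigmaOn_mono (systemSources_mono (j.le_add_right t)))) le_rfl

lemma measurable_predErr (h : s.IsModel μ A C Q R Pbar lam lamE) (j t : ℕ) :
    Measurable (s.predErr μ A C j t) :=
  (h.measurable_predErr_sigmaOn j t).mono (h.sigmaOn_le _) le_rfl

end

-- The noises `w k` and `v (k + 1)` are independent of all states and measurements up to time k, so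
-- adjoining them keeps the law Gaussian, and the next state and measurement are a linear image.
omit [IsProbabilityMeasure μ] in
lemma hasGaussianLaw_state_meas (h : s.IsModel μ A C Q R Pbar lam lamE) (k : ℕ) :
    HasGaussianLaw (fun ω => (s.state A k ω, fun i : Fin (k + 1) => s.meas A C i ω)) μ := by
  have hw : ∀ k, HasGaussianLaw (s.w k) μ := fun k => ⟨by rw [h.law_process k]; infer_instance⟩
  have hv : ∀ k, HasGaussianLaw (s.v k) μ := fun k => ⟨by rw [h.law_sensor k]; infer_instance⟩
  induction k with
  | zero =>
    have hx : HasGaussianLaw s.x₀ μ := ⟨h.law_init⟩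
    have hind : IndepFun s.x₀ (s.v 0) μ :=
      h.independent.indep (i := .init) (j := .sensor 0) (by simp)
    have heq : (fun ω => (s.state A 0 ω, fun i : Fin (0 + 1) => s.meas A C i ω)) =
        fun ω => (s.x₀ ω, fun _ : Fin (0 + 1) => Matrix.toEuclideanLin C (s.x₀ ω) + s.v 0 ω) := by
      funext ω
      refine Prod.ext rfl (funext fun i => ?_)
      have hi : (i : ℕ) = 0 := by omega
      simp only [hi]
      rfl
    rw [heq]
    exact gaussian_initial_meas C (hind.hasGaussianLaw hx (hv 0))
  | succ k ih =>
    have hsub : MeasurableSpace.comap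
        (fun ω => (s.state A k ω, fun i : Fin (k + 1) => s.meas A C i ω)) inferInstance
        ≤ s.sigmaOn (systemSources k) := by
      refine Measurable.comap_le ?_
      refine (s.measurable_state_sigmaOn A k).prodMk ?_
      exact measurable_iff_comap_le.2 (s.sensorInfo_le_sigmaOn A C k)
    have hwsub : s.sigma (.process k) ≤ s.sigmaOn {.process k} := s.sigma_le_sigmaOn rfl
    have hvsub : s.sigma (.sensor (k + 1)) ≤ s.sigmaOn {.sensor (k + 1)} := s.sigma_le_sigmaOn rfl
    have hind₁ : IndepFun (fun ω => (s.state A k ω, fun i : Fin (k + 1) => s.meas A C i ω))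
        (s.w k) μ := by
      have hd : Disjoint (systemSources k) {.process k} := by simp [systemSources]
      exact indep_of_indep_of_le_left (indep_of_indep_of_le_right (h.indep_sigmaOn hd) hwsub) hsub
    have hind₂ : IndepFun
        (fun ω => ((s.state A k ω, fun i : Fin (k + 1) => s.meas A C i ω), s.w k ω))
        (s.v (k + 1)) μ := by
      have hd : Disjoint (systemSources k ∪ {.process k}) {.sensor (k + 1)} := by
        simp [systemSources]
      refine indep_of_indep_of_le_left (indep_of_indep_of_le_right (h.indep_sigmaOn hd) hvsub) ?_
      · refine Measurable.comap_le (Measurable.prodMk ?_ ?_)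
        · exact measurable_iff_comap_le.2 (hsub.trans (s.sigmaOn_mono Set.subset_union_left))
        · exact measurable_iff_comap_le.2 (hwsub.trans (s.sigmaOn_mono Set.subset_union_right))
    have hg := gaussian_step_meas A C (hind₂.hasGaussianLaw (hind₁.hasGaussianLaw ih (hw k))
      (hv (k + 1)))
    have heq : (fun ω => (s.state A (k + 1) ω, fun i : Fin (k + 1 + 1) => s.meas A C i ω)) =
        fun ω => (Matrix.toEuclideanLin A (s.state A k ω) + s.w k ω, fun i : Fin (k + 1 + 1) =>
          if hi : (i : ℕ) < k + 1 then s.meas A C (⟨i, hi⟩ : Fin (k + 1)) ω else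
            Matrix.toEuclideanLin C (Matrix.toEuclideanLin A (s.state A k ω) + s.w k ω) +
              s.v (k + 1) ω) := by
      funext ω
      refine Prod.ext rfl (funext fun i => ?_)
      by_cases hi : (i : ℕ) < k + 1
      · simp [hi]
      · have : (i : ℕ) = k + 1 := by omega
        simp only [this, lt_irrefl, dite_false]
        rfl
    rw [heq]
    exact hg

omit [IsProbabilityMeasure μ] in
lemma memLp_state (h : s.IsModel μ A C Q R Pbar lam lamE) (k : ℕ) :
    MemLp (s.state A k) 2 μ :=
  (h.hasGaussianLaw_state_meas k).fst.memLp_two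

/-- At t = 0 this is Gaussian regression; each further step only adds fresh process noise. Channel
outcomes of all times, including later ones, can be adjoined because decisions never look at the
states. This is why a random time of last reception does no harm. -/
lemma indep_predErr (h : s.IsModel μ A C Q R Pbar lam lamE) (j t : ℕ) :
    Indep (MeasurableSpace.comap (s.predErr μ A C j t) inferInstance) (s.fullInfo A C j) μ := by
  have hYm : Measurable (fun ω (i : Fin (j + 1)) => s.meas A C i ω) :=
    measurable_iff_comap_le.2 (h.sensorInfo_le j)
  have hchan : ∀ k, Disjoint (systemSources k) channelSources := by
    intro k
    rw [Set.disjoint_left]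
    rintro i (rfl | ⟨l, -, rfl⟩ | ⟨l, -, rfl⟩) ⟨k', h | h⟩ <;> cases h
  induction t with
  | zero =>
    have hreg := (gaussian_regression hYm (h.hasGaussianLaw_state_meas j)).2
    have hreg' : Indep (MeasurableSpace.comap (s.predErr μ A C j 0) inferInstance)
      (s.sensorInfo A C j) μ := hreg
    refine indep_sup_right_of_indep_sup_left (h.measurable_predErr j 0).comap_le
      (h.sensorInfo_le j) (h.sigmaOn_le _) hreg' ?_
    refine indep_of_indep_of_le_left (h.indep_sigmaOn (hchan j)) ?_
    exact sup_le (h.measurable_predErr_sigmaOn j 0).comap_le (s.sensorInfo_le_sigmaOn A C j)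
  | succ t ih =>
    have hw : Indep (s.fullInfo A C j ⊔ MeasurableSpace.comap (s.predErr μ A C j t) inferInstance)
        (s.sigma (.process (j + t))) μ := by
      refine indep_of_indep_of_le_left (indep_of_indep_of_le_right (h.indep_sigmaOn
        (S := systemSources (j + t) ∪ channelSources) (T := {.process (j + t)}) ?_)
        (s.sigma_le_sigmaOn rfl)) (sup_le (sup_le ?_ ?_) ?_)
      · simp [systemSources, channelSources]
      · exact (s.sensorInfo_le_sigmaOn A C j).trans (s.sigmaOn_mono
          ((systemSources_mono (j.le_add_right t)).trans Set.subset_union_left))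
      · exact s.sigmaOn_mono Set.subset_union_right
      · exact (h.measurable_predErr_sigmaOn j t).comap_le.trans
          (s.sigmaOn_mono Set.subset_union_left)
    have := indep_sup_right_of_indep_sup_left (h.fullInfo_le j) (h.measurable_predErr j t).comap_le
      (h.sigma_le _) ih.symm hw
    refine indep_of_indep_of_le_left this.symm (Measurable.comap_le ?_)
    have heq : s.predErr μ A C j (t + 1) = fun ω =>
        Matrix.toEuclideanLin A (s.predErr μ A C j t ω) + s.w (j + t) ω :=
      funext fun ω => s.predErr_succ μ A C j t ω
    rw [heq]
    refine Measurable.add ((measurable_toEuclideanLin A).comp ?_) ?_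
    · exact measurable_iff_comap_le.2 le_sup_left
    · exact measurable_iff_comap_le.2 (le_sup_right (b := s.sigma (.process (j + t))))

omit [IsProbabilityMeasure μ] in
lemma indepFun_predErr_process (h : s.IsModel μ A C Q R Pbar lam lamE) (j t : ℕ) :
    IndepFun (s.predErr μ A C j t) (s.w (j + t)) μ := by
  refine indep_of_indep_of_le_left (indep_of_indep_of_le_right (h.indep_sigmaOn
    (S := systemSources (j + t)) (T := {.process (j + t)}) ?_)
    (s.sigma_le_sigmaOn (i := .process (j + t)) rfl))
    (h.measurable_predErr_sigmaOn j t).comap_le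
  simp [systemSources]

lemma hasGaussianLaw_predErr_zero (h : s.IsModel μ A C Q R Pbar lam lamE) (j : ℕ) :
    HasGaussianLaw (s.predErr μ A C j 0) μ :=
  (gaussian_regression (measurable_iff_comap_le.2 (h.sensorInfo_le j))
    (h.hasGaussianLaw_state_meas j)).1

lemma integral_predErr_zero_mul (h : s.IsModel μ A C Q R Pbar lam lamE) (j : ℕ) (a b : Fin n) :
    ∫ ω, s.predErr μ A C j 0 ω a * s.predErr μ A C j 0 ω b ∂μ = Pbar a b := by
  have hle := h.sensorInfo_le j
  have h1 := integral_condExp (μ := μ) hle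
    (f := fun ω => s.predErr μ A C j 0 ω a * s.predErr μ A C j 0 ω b)
  rw [← h1]
  have : (μ[fun ω => s.predErr μ A C j 0 ω a * s.predErr μ A C j 0 ω b | s.sensorInfo A C j])
      =ᵐ[μ] fun _ => Pbar a b := by
    filter_upwards [h.steady_state j] with ω hω
    rw [← hω]
    rfl
  rw [integral_congr_ae this]
  simp

lemma integral_inner_predErr_zero (h : s.IsModel μ A C Q R Pbar lam lamE) (j : ℕ) (u : Vec n) :
    ∫ ω, inner ℝ u (s.predErr μ A C j 0 ω) ∂μ = 0 := by
  have hint : Integrable (s.state A j) μ := (h.memLp_state j).integrable one_le_two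
  have hint' : Integrable (s.predErr μ A C j 0) μ :=
    (h.hasGaussianLaw_predErr_zero j).memLp_two.integrable one_le_two
  rw [integral_inner hint']
  have : ∫ ω, s.predErr μ A C j 0 ω ∂μ = 0 := by
    change ∫ ω, (s.state A j ω - s.localEst μ A C j ω) ∂μ = 0
    rw [integral_sub (g := s.localEst μ A C j) hint integrable_condExp, localEst,
      integral_condExp (h.sensorInfo_le j),
      sub_self]
  rw [this, inner_zero_right]

lemma integral_inner_predErr_zero_sq (h : s.IsModel μ A C Q R Pbar lam lamE) (j : ℕ)
    (u : Vec n) :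
    ∫ ω, (inner ℝ u (s.predErr μ A C j 0 ω) : ℝ) ^ 2 ∂μ = quadForm Pbar u := by
  have hm : ∀ i, MemLp (fun ω => s.predErr μ A C j 0 ω i) 2 μ := fun i =>
    (h.hasGaussianLaw_predErr_zero j).memLp_two.continuousLinearMap_comp
      (EuclideanSpace.proj i : Vec n →L[ℝ] ℝ)
  have heq : ∀ ω, (inner ℝ u (s.predErr μ A C j 0 ω) : ℝ) ^ 2 = ∑ a, ∑ b, u a * u b *
      (s.predErr μ A C j 0 ω a * s.predErr μ A C j 0 ω b) := by
    intro ω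
    simp only [PiLp.inner_apply, sq, Finset.sum_mul_sum]
    refine Finset.sum_congr rfl fun a _ => Finset.sum_congr rfl fun b _ => ?_
    simp
    ring
  have hint : ∀ a b, Integrable (fun ω => u a * u b *
      (s.predErr μ A C j 0 ω a * s.predErr μ A C j 0 ω b)) μ := fun a b =>
    ((hm a).integrable_mul (hm b)).const_mul _
  simp only [heq]
  rw [integral_finsetSum _ fun a _ => integrable_finsetSum _ fun b _ => hint a b]
  refine Finset.sum_congr rfl fun a _ => ?_
  rw [integral_finsetSum _ fun b _ => hint a b]
  refine Finset.sum_congr rfl fun b _ => ?_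
  rw [integral_const_mul, h.integral_predErr_zero_mul]

omit [IsProbabilityMeasure μ] in
lemma map_inner_process (h : s.IsModel μ A C Q R Pbar lam lamE) (hQ : Q.PosDef) (k : ℕ)
    (u : Vec n) :
    μ.map (fun ω => (inner ℝ u (s.w k ω) : ℝ)) = gaussianReal 0 (quadForm Q u).toNNReal := by
  have h1 : μ.map (fun ω => (inner ℝ u (s.w k ω) : ℝ)) =
      (multivariateGaussian 0 Q).map (fun x => innerSL ℝ u x) := by
    rw [← h.law_process k, Measure.map_map (by fun_prop) (h.measurable_process k)]
    rfl
  rw [h1, IsGaussian.map_eq_gaussianReal]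
  congr 1
  · rw [ContinuousLinearMap.integral_comp_id_comm IsGaussian.integrable_id]
    simp
  · congr 1
    rw [quadForm_eq_dotProduct, ← covarianceBilin_multivariateGaussian (μ := 0) hQ.posSemidef]
    rw [covarianceBilin_self IsGaussian.memLp_two_id]
    rfl

lemma quadForm_nonneg (h : s.IsModel μ A C Q R Pbar lam lamE) (u : Vec n) :
    0 ≤ quadForm Pbar u := by
  rw [← h.integral_inner_predErr_zero_sq 0 u]
  exact integral_nonneg fun ω => sq_nonneg _

end IsModel

end Primitives

lemma quadForm_pos {n : ℕ} {Q : Matrix (Fin n) (Fin n) ℝ} (hQ : Q.PosDef) {u : Vec n}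
    (hu : u ≠ 0) : 0 < quadForm Q u := by
  rw [quadForm_eq_dotProduct]
  have := hQ.dotProduct_mulVec_pos (x := u.ofLp) (by simpa using hu)
  simpa using this

lemma quadForm_nonneg_of_posDef {n : ℕ} {Q : Matrix (Fin n) (Fin n) ℝ} (hQ : Q.PosDef)
    (u : Vec n) : 0 ≤ quadForm Q u := by
  by_cases hu : u = 0
  · simp [hu, quadForm]
  · exact (quadForm_pos hQ hu).le

lemma predVar_nonneg {n : ℕ} {A Q P : Matrix (Fin n) (Fin n) ℝ} (hQ : Q.PosDef)
    (hP : ∀ u, 0 ≤ quadForm P u) (t : ℕ) (u : Vec n) : 0 ≤ predVar A Q P t u := by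
  induction t generalizing u with
  | zero => exact hP u
  | succ t ih => exact add_nonneg (ih _) (quadForm_nonneg_of_posDef hQ u)

namespace Primitives.IsModel

variable {n m : ℕ} {Ω : Type*} [mΩ : MeasurableSpace Ω]
  {s : Primitives n m Ω} {μ : Measure Ω} [IsProbabilityMeasure μ]
  {A : Matrix (Fin n) (Fin n) ℝ} {C : Matrix (Fin m) (Fin n) ℝ} {Q : Matrix (Fin n) (Fin n) ℝ}
  {R : Matrix (Fin m) (Fin m) ℝ} {Pbar : Matrix (Fin n) (Fin n) ℝ} {lam lamE : ℝ}

/-- Moving A onto the direction as its transpose turns one prediction step into a sum of two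
independent centred Gaussians, which is the recursion defining `predVar`. -/
lemma map_inner_predErr (h : s.IsModel μ A C Q R Pbar lam lamE) (hQ : Q.PosDef) (j t : ℕ)
    (u : Vec n) :
    μ.map (fun ω => (inner ℝ u (s.predErr μ A C j t ω) : ℝ)) =
      gaussianReal 0 (predVar A Q Pbar t u).toNNReal := by
  induction t generalizing u with
  | zero =>
    have hg : HasGaussianLaw (fun ω => (inner ℝ u (s.predErr μ A C j 0 ω) : ℝ)) μ :=
      (h.hasGaussianLaw_predErr_zero j).map_fun (innerSL ℝ u)
    rw [hg.map_eq_gaussianReal, h.integral_inner_predErr_zero]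
    congr 2
    rw [variance_of_integral_eq_zero hg.aemeasurable (h.integral_inner_predErr_zero j u),
      h.integral_inner_predErr_zero_sq]
    rfl
  | succ t ih =>
    have hind : IndepFun
        (fun ω => (inner ℝ (Matrix.toEuclideanLin A.transpose u) (s.predErr μ A C j t ω) : ℝ))
        (fun ω => (inner ℝ u (s.w (j + t) ω) : ℝ)) μ :=
      (h.indepFun_predErr_process j t).comp
        (φ := fun x => (inner ℝ (Matrix.toEuclideanLin A.transpose u) x : ℝ))
        (ψ := fun x => (inner ℝ u x : ℝ)) (by fun_prop) (by fun_prop)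
    have := gaussianReal_add_gaussianReal_of_indepFun hind (ih _) (h.map_inner_process hQ (j + t) u)
    rw [add_zero, ← Real.toNNReal_add (predVar_nonneg hQ h.quadForm_nonneg _ _)
      (quadForm_nonneg_of_posDef hQ _)] at this
    rw [predVar, ← this]
    congr 1
    ext ω
    rw [s.predErr_succ, inner_add_right, inner_toEuclideanLin]
    rfl

end Primitives.IsModel

/-! ### One-dimensional Gaussian integrals. -/

section GaussianIntegrals

open Real

/-- The integrand is the density of N(c, σ) divided by that of N(0, s), so the integral is one for
every centre c. -/
lemma lintegral_exp_gaussian_ratio {σ s a : ℝ} (hσ : 0 < σ) (hs : 0 < s)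
    (ha : a = 1 / 2 * log (s / σ)) (c : ℝ) :
    ∫⁻ r, ENNReal.ofReal (exp (a - (r - c) ^ 2 / (2 * σ) + r ^ 2 / (2 * s)))
      ∂(gaussianReal 0 s.toNNReal) = 1 := by
  have hs' : s.toNNReal ≠ 0 := by simpa using hs
  have hσ' : σ.toNNReal ≠ 0 := by simpa using hσ
  rw [gaussianReal_of_var_ne_zero _ hs',
    lintegral_withDensity_eq_lintegral_mul₀ (measurable_gaussianPDF _ _).aemeasurable
      (by fun_prop), ← lintegral_gaussianPDF_eq_one c hσ']
  refine lintegral_congr fun r => ?_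
  rw [Pi.mul_apply, gaussianPDF, gaussianPDF, ← ENNReal.ofReal_mul (gaussianPDFReal_nonneg _ _ _)]
  congr 1
  simp only [gaussianPDFReal, Real.coe_toNNReal _ hs.le, Real.coe_toNNReal _ hσ.le, sub_zero]
  have hexp : exp a = √(2 * π * s) * (√(2 * π * σ))⁻¹ := by
    rw [ha, ← div_eq_mul_inv, ← sqrt_div (by positivity),
      mul_div_mul_left _ _ (by positivity), sqrt_eq_rpow, rpow_def_of_pos (by positivity), mul_comm]
  have h1 : √(2 * π * s) ≠ 0 := by positivity
  have : exp (a - (r - c) ^ 2 / (2 * σ) + r ^ 2 / (2 * s)) =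
      exp a * exp (-(r - c) ^ 2 / (2 * σ)) * (exp (-r ^ 2 / (2 * s)))⁻¹ := by
    rw [← exp_add, ← exp_neg, ← exp_add]
    congr 1
    ring
  rw [this, hexp]
  field_simp

lemma integrable_sq_gaussianReal (s : NNReal) : Integrable (fun r : ℝ => r ^ 2) (gaussianReal 0 s) :=
  (memLp_id_gaussianReal (μ := 0) (v := s) 2).integrable_sq

lemma integral_sq_gaussianReal (s : NNReal) : ∫ r, r ^ 2 ∂(gaussianReal 0 s) = s := by
  have h := variance_id_gaussianReal (μ := 0) (v := s)
  rw [variance_of_integral_eq_zero aemeasurable_id (by simp)] at h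
  simpa using h

lemma le_lintegral_sq_gaussianReal (s : NNReal) (c : ℝ) :
    (s : ENNReal) ≤ ∫⁻ r, ENNReal.ofReal ((c + r) ^ 2) ∂(gaussianReal 0 s) := by
  have hid : Integrable (fun r : ℝ => r) (gaussianReal 0 s) :=
    (memLp_id_gaussianReal (μ := 0) (v := s) 1).integrable le_rfl
  have h1 : Integrable (fun r : ℝ => (c + r) ^ 2) (gaussianReal 0 s) := by
    have : (fun r : ℝ => (c + r) ^ 2) = fun r => c ^ 2 + 2 * c * r + r ^ 2 := by ext; ring
    rw [this]
    exact ((integrable_const _).add (hid.const_mul _)).add (integrable_sq_gaussianReal s)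
  rw [← ofReal_integral_eq_lintegral_ofReal h1 (ae_of_all _ fun r => sq_nonneg _)]
  have : ∫ r, (c + r) ^ 2 ∂(gaussianReal 0 s) = c ^ 2 + s := by
    have : (fun r : ℝ => (c + r) ^ 2) = fun r => c ^ 2 + 2 * c * r + r ^ 2 := by ext; ring
    rw [this, integral_add (f := fun r => c ^ 2 + 2 * c * r)
      ((integrable_const _).add (hid.const_mul _)) (integrable_sq_gaussianReal s),
      integral_add (integrable_const _) (hid.const_mul _),
      integral_const_mul, integral_sq_gaussianReal, integral_id_gaussianReal]
    simp
  rw [this, ← ENNReal.ofReal_coe_nnreal]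
  exact ENNReal.ofReal_le_ofReal (by nlinarith [sq_nonneg c])

end GaussianIntegrals

/-! ### The last success of a Boolean sequence. -/

section LastTrue

/-- The last positive index up to `k` at which `b` is true, zero if there is none. -/
def lastTrue (b : ℕ → Bool) : ℕ → ℕ
  | 0 => 0
  | k + 1 => if b (k + 1) then k + 1 else lastTrue b k

lemma lastTrue_le (b : ℕ → Bool) (k : ℕ) : lastTrue b k ≤ k := by
  induction k with
  | zero => exact le_rfl
  | succ k ih =>
    rw [lastTrue]
    split_ifs
    · exact le_rfl
    · exact ih.trans k.le_succ

lemma eq_false_of_lastTrue_lt (b : ℕ → Bool) {k i : ℕ} (h : lastTrue b k < i) (hik : i ≤ k) :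
    b i = false := by
  induction k with
  | zero => omega
  | succ k ih =>
    rw [lastTrue] at h
    split_ifs at h with hb
    · omega
    · rcases hik.lt_or_eq with hlt | rfl
      · exact ih h (Nat.le_of_lt_succ hlt)
      · simpa using hb

lemma lastTrue_eq_true {b : ℕ → Bool} (h0 : b 0 = true) (k : ℕ) : b (lastTrue b k) = true := by
  induction k with
  | zero => exact h0
  | succ k ih =>
    rw [lastTrue]
    split_ifs with hb
    · exact hb
    · exact ih

lemma lastTrue_mono {b c : ℕ → Bool} (h : ∀ i, 0 < i → b i = true → c i = true) (k : ℕ) :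
    lastTrue b k ≤ lastTrue c k := by
  induction k with
  | zero => exact le_rfl
  | succ k ih =>
    by_cases hb : b (k + 1) = true
    · simp [lastTrue, hb, h _ k.succ_pos hb]
    · rw [lastTrue, if_neg hb, lastTrue]
      split_ifs
      · exact (ih.trans (lastTrue_le c k)).trans k.le_succ
      · exact ih

lemma lastTrue_congr {b c : ℕ → Bool} {k : ℕ} (h : ∀ i ≤ k, b i = c i) :
    lastTrue b k = lastTrue c k := by
  induction k with
  | zero => rfl
  | succ k ih =>
    rw [lastTrue, lastTrue, h _ le_rfl, ih fun i hi => h i (hi.trans k.le_succ)]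

lemma measurable_lastTrue {α : Type*} {mα : MeasurableSpace α} {b : ℕ → α → Bool} {k : ℕ}
    (hb : ∀ i ≤ k, Measurable (b i)) : Measurable fun a => lastTrue (fun i => b i a) k := by
  induction k with
  | zero => exact measurable_const
  | succ k ih =>
    exact Measurable.ite ((hb _ le_rfl) (measurableSet_singleton true)) measurable_const
      (ih fun i hi => hb i (hi.trans k.le_succ))

end LastTrue

/-! ### Splitting integrals over the values of a bounded random time. -/

section Fibers

variable {Ω : Type*} {mΩ : MeasurableSpace Ω} {μ : Measure Ω} {N : Ω → ℕ} {k : ℕ}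

lemma iUnion_fiber_eq_univ (hk : ∀ ω, N ω ≤ k) :
    ⋃ j ∈ Finset.range (k + 1), {ω | N ω = j} = Set.univ := by
  ext ω
  simpa using Nat.lt_succ_of_le (hk ω)

lemma pairwise_disjoint_fiber (S : Set ℕ) : S.PairwiseDisjoint fun j => {ω | N ω = j} :=
  fun _ _ _ _ hij => Set.disjoint_left.2 fun _ h h' => hij (h.symm.trans h')

lemma lintegral_eq_sum_fiber (hN : Measurable N) (hk : ∀ ω, N ω ≤ k) (f : Ω → ENNReal) :
    ∫⁻ ω, f ω ∂μ = ∑ j ∈ Finset.range (k + 1), ∫⁻ ω in {ω | N ω = j}, f ω ∂μ := by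
  rw [← lintegral_biUnion_finset (pairwise_disjoint_fiber _)
    (fun j _ => hN (measurableSet_singleton j)), iUnion_fiber_eq_univ hk, Measure.restrict_univ]

lemma integral_eq_sum_fiber (hN : Measurable N) (hk : ∀ ω, N ω ≤ k) {f : Ω → ℝ}
    (hf : ∀ j ≤ k, IntegrableOn f {ω | N ω = j} μ) :
    ∫ ω, f ω ∂μ = ∑ j ∈ Finset.range (k + 1), ∫ ω in {ω | N ω = j}, f ω ∂μ := by
  rw [← integral_biUnion_finset (s := fun j => {ω | N ω = j}) _
    (fun j _ => hN (measurableSet_singleton j))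
    (pairwise_disjoint_fiber _) (fun j hj => hf j (Nat.le_of_lt_succ (Finset.mem_range.1 hj))),
    iUnion_fiber_eq_univ hk, Measure.restrict_univ]

lemma integrable_of_fiber (hk : ∀ ω, N ω ≤ k) {f : Ω → ℝ}
    (hf : ∀ j ≤ k, IntegrableOn f {ω | N ω = j} μ) : Integrable f μ := by
  rw [← integrableOn_univ, ← iUnion_fiber_eq_univ hk, integrableOn_finset_iUnion]
  exact fun j hj => hf j (Nat.le_of_lt_succ (Finset.mem_range.1 hj))

lemma setIntegral_of_indep [IsProbabilityMeasure μ] {G : MeasurableSpace Ω} (hG : G ≤ mΩ)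
    {f : Ω → ℝ} (hf : Measurable[mΩ] f)
    (hind : Indep (MeasurableSpace.comap f inferInstance) G μ) {B : Set Ω}
    (hB : MeasurableSet[G] B) : ∫ ω in B, f ω ∂μ = μ.real B * ∫ ω, f ω ∂μ := by
  have hm : Measurable[G] (B.indicator fun _ => (1 : ℝ)) := measurable_const.indicator hB
  have hI : IndepFun (B.indicator fun _ => (1 : ℝ)) f μ :=
    indep_of_indep_of_le_left hind.symm hm.comap_le
  have := hI.integral_fun_mul_eq_mul_integral (hm.mono hG le_rfl).aestronglyMeasurable
    hf.aestronglyMeasurable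
  rw [integral_indicator (hG _ hB), setIntegral_const, smul_eq_mul, mul_one] at this
  rw [← this, ← integral_indicator (hG _ hB)]
  congr 1
  ext ω
  by_cases h : ω ∈ B <;> simp [h]

end Fibers

/-! ### Growth of the prediction variance along an unstable left eigenvector. -/

section UnstableDirection

variable {n : ℕ}

/-- The two new vectors are the real and imaginary parts of (α + iβ)(a + ib); in the sum of the
forms the cross terms cancel. -/
lemma quadForm_smul_add_smul (M : Matrix (Fin n) (Fin n) ℝ) (α β : ℝ) (a b : Vec n) :
    quadForm M (α • a - β • b) + quadForm M (β • a + α • b) =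
      (α ^ 2 + β ^ 2) * (quadForm M a + quadForm M b) := by
  simp only [quadForm, ← Finset.sum_add_distrib, Finset.mul_sum]
  refine Finset.sum_congr rfl fun i _ => Finset.sum_congr rfl fun j _ => ?_
  simp
  ring

lemma predVar_smul_add_smul (A Q P : Matrix (Fin n) (Fin n) ℝ) (t : ℕ) (α β : ℝ) (a b : Vec n) :
    predVar A Q P t (α • a - β • b) + predVar A Q P t (β • a + α • b) =
      (α ^ 2 + β ^ 2) * (predVar A Q P t a + predVar A Q P t b) := by
  induction t generalizing a b with
  | zero => exact quadForm_smul_add_smul P α β a b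
  | succ t ih =>
    simp only [predVar, map_add, map_sub, map_smul]
    have := ih (Matrix.toEuclideanLin A.transpose a) (Matrix.toEuclideanLin A.transpose b)
    have := quadForm_smul_add_smul Q α β a b
    linarith

/-- Real and imaginary part of a left eigenvector for an unstable eigenvalue. -/
lemma exists_unstable_pair {A : Matrix (Fin n) (Fin n) ℝ} (hA : IsUnstable A) :
    ∃ (α β : ℝ) (a b : Vec n), 1 < α ^ 2 + β ^ 2 ∧ (a ≠ 0 ∨ b ≠ 0) ∧
      Matrix.toEuclideanLin A.transpose a = α • a - β • b ∧
      Matrix.toEuclideanLin A.transpose b = β • a + α • b := by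
  obtain ⟨z, hz, hz1⟩ := hA
  rw [spectrum.mem_iff, Matrix.isUnit_iff_isUnit_det, isUnit_iff_ne_zero, not_not,
    ← Matrix.exists_vecMul_eq_zero_iff] at hz
  obtain ⟨v, hv0, hv⟩ := hz
  have hv' : ∀ j, ∑ i, v i * (A i j : ℂ) = z * v j := by
    intro j
    have h1 := congrFun hv j
    rw [Matrix.vecMul_sub, Pi.sub_apply, Pi.zero_apply, sub_eq_zero,
      Matrix.algebraMap_eq_diagonal, Matrix.vecMul_diagonal] at h1
    rw [Pi.algebraMap_apply, Algebra.algebraMap_self, RingHom.id_apply] at h1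
    rw [mul_comm z, h1]
    rfl
  refine ⟨z.re, z.im, WithLp.toLp 2 fun i => (v i).re, WithLp.toLp 2 fun i => (v i).im, ?_, ?_,
    ?_, ?_⟩
  · rw [← one_lt_sq_iff₀ (norm_nonneg z), Complex.sq_norm, Complex.normSq_apply] at hz1
    nlinarith
  · by_contra hcon
    push Not at hcon
    refine hv0 (funext fun i => Complex.ext ?_ ?_)
    · simpa using congrArg (fun x : Vec n => x i) hcon.1
    · simpa using congrArg (fun x : Vec n => x i) hcon.2
  · ext j
    have h := congrArg Complex.re (hv' j)
    simp only [Complex.re_sum, Complex.mul_re, Complex.ofReal_re, Complex.ofReal_im] at h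
    simp only [Matrix.toLpLin_apply, Matrix.mulVec, dotProduct, Matrix.transpose_apply]
    simp
    rw [← h]
    exact Finset.sum_congr rfl fun i _ => by ring
  · ext j
    have h := congrArg Complex.im (hv' j)
    simp only [Complex.im_sum, Complex.mul_im, Complex.ofReal_re, Complex.ofReal_im] at h
    simp only [Matrix.toLpLin_apply, Matrix.mulVec, dotProduct, Matrix.transpose_apply]
    simp
    rw [add_comm, ← h]
    exact Finset.sum_congr rfl fun i _ => by ring

variable {A Q P : Matrix (Fin n) (Fin n) ℝ} {α β : ℝ} {a b : Vec n}

lemma predVar_pair_succ (ha : Matrix.toEuclideanLin A.transpose a = α • a - β • b)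
    (hb : Matrix.toEuclideanLin A.transpose b = β • a + α • b) (t : ℕ) :
    predVar A Q P (t + 1) a + predVar A Q P (t + 1) b =
      (α ^ 2 + β ^ 2) * (predVar A Q P t a + predVar A Q P t b) +
        (quadForm Q a + quadForm Q b) := by
  rw [← predVar_smul_add_smul, predVar, predVar, ha, hb]
  ring

lemma quadForm_pair_pos (hQ : Q.PosDef) (hab : a ≠ 0 ∨ b ≠ 0) :
    0 < quadForm Q a + quadForm Q b := by
  rcases hab with h | h
  · exact add_pos_of_pos_of_nonneg (quadForm_pos hQ h) (quadForm_nonneg_of_posDef hQ b)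
  · exact add_pos_of_nonneg_of_pos (quadForm_nonneg_of_posDef hQ a) (quadForm_pos hQ h)

lemma pow_mul_lt_predVar_pair (hQ : Q.PosDef) (hab : a ≠ 0 ∨ b ≠ 0)
    (ha : Matrix.toEuclideanLin A.transpose a = α • a - β • b)
    (hb : Matrix.toEuclideanLin A.transpose b = β • a + α • b) (t : ℕ) :
    (α ^ 2 + β ^ 2) ^ (t + 1) * (quadForm P a + quadForm P b) <
      predVar A Q P (t + 1) a + predVar A Q P (t + 1) b := by
  have hq := quadForm_pair_pos hQ hab
  induction t with
  | zero =>
    rw [predVar_pair_succ ha hb]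
    simp only [predVar, zero_add, pow_one]
    linarith
  | succ t ih =>
    rw [predVar_pair_succ ha hb, pow_succ']
    nlinarith

/-- The strict bound holds for the sum over a and b, hence for at least one of them; which one may
depend on t. -/
lemma exists_direction (hQ : Q.PosDef) (hab : a ≠ 0 ∨ b ≠ 0)
    (ha : Matrix.toEuclideanLin A.transpose a = α • a - β • b)
    (hb : Matrix.toEuclideanLin A.transpose b = β • a + α • b) (t : ℕ) :
    ∃ u, (α ^ 2 + β ^ 2) ^ (t + 1) * quadForm P u < predVar A Q P (t + 1) u := by
  have h := pow_mul_lt_predVar_pair (P := P) hQ hab ha hb t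
  by_contra! hcon
  have h1 := hcon a
  have h2 := hcon b
  linarith

/-- With r = α² + β², the factor (r - 1)/r makes the two sides of the induction step, cleared of
denominators, differ by the perfect square ((r - 1)t - 1)². -/
lemma sq_le_predVar_pair (hQ : Q.PosDef) (hP : ∀ u, 0 ≤ quadForm P u)
    (hαβ : 1 < α ^ 2 + β ^ 2)
    (ha : Matrix.toEuclideanLin A.transpose a = α • a - β • b)
    (hb : Matrix.toEuclideanLin A.transpose b = β • a + α • b) (t : ℕ) :
    (quadForm Q a + quadForm Q b) * ((α ^ 2 + β ^ 2 - 1) / (α ^ 2 + β ^ 2)) * (t : ℝ) ^ 2 ≤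
      predVar A Q P t a + predVar A Q P t b := by
  have hq : 0 ≤ quadForm Q a + quadForm Q b :=
    add_nonneg (quadForm_nonneg_of_posDef hQ a) (quadForm_nonneg_of_posDef hQ b)
  set q := quadForm Q a + quadForm Q b
  set r := α ^ 2 + β ^ 2
  have hr : 0 < r := by linarith
  induction t with
  | zero => simpa [predVar] using add_nonneg (hP a) (hP b)
  | succ t ih =>
    rw [predVar_pair_succ ha hb]
    refine le_trans ?_ (add_le_add_left (mul_le_mul_of_nonneg_left ih hr.le) q)
    have key : (r - 1) / r * ((t : ℝ) + 1) ^ 2 ≤ (r - 1) * (t : ℝ) ^ 2 + 1 := by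
      rw [div_mul_eq_mul_div, div_le_iff₀ hr]
      nlinarith [sq_nonneg ((r - 1) * (t : ℝ) - 1)]
    have := mul_le_mul_of_nonneg_left key hq
    push_cast
    calc q * ((r - 1) / r) * ((t : ℝ) + 1) ^ 2 = q * ((r - 1) / r * ((t : ℝ) + 1) ^ 2) := by ring
      _ ≤ q * ((r - 1) * (t : ℝ) ^ 2 + 1) := this
      _ = r * (q * ((r - 1) / r) * (t : ℝ) ^ 2) + q := by field_simp

end UnstableDirection

/-! ### Functions of a receiver's record. -/

/-- The contents of what a receiver learns at one time. -/
abbrev Packet (n : ℕ) : Type := Bool × Bool × Vec n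

section Receiver

variable {n : ℕ}

/-- The last time of a reception in a record of length `k + 1`. -/
def lastReception {k : ℕ} (y : Fin (k + 1) → Packet n) : ℕ :=
  lastTrue (fun i => if hi : i < k + 1 then (y ⟨i, hi⟩).2.1 else false) k

lemma lastReception_le {k : ℕ} (y : Fin (k + 1) → Packet n) : lastReception y ≤ k :=
  lastTrue_le _ _

lemma measurable_lastReception {k : ℕ} :
    Measurable (lastReception : (Fin (k + 1) → Packet n) → ℕ) := by
  refine measurable_lastTrue (b := fun i (y : Fin (k + 1) → Packet n) =>
    if hi : i < k + 1 then (y ⟨i, hi⟩).2.1 else false) fun i _ => ?_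
  by_cases hi : i < k + 1
  · simp only [hi, dite_true]
    fun_prop
  · simp only [hi, dite_false]
    fun_prop

/-- The prediction for time `k + 1` from the last estimate received up to time `k`. -/
noncomputable def recordPrediction (A : Matrix (Fin n) (Fin n) ℝ) {k : ℕ}
    (y : Fin (k + 1) → Packet n) : Vec n :=
  ((Matrix.toEuclideanLin A) ^ (k + 1 - lastReception y))
    (y ⟨lastReception y, Nat.lt_succ_of_le (lastReception_le y)⟩).2.2

lemma measurable_recordPrediction (A : Matrix (Fin n) (Fin n) ℝ) {k : ℕ} :
    Measurable (recordPrediction A : (Fin (k + 1) → Packet n) → Vec n) := by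
  let f : Fin (k + 1) → (Fin (k + 1) → Packet n) → Vec n := fun j y =>
    ((Matrix.toEuclideanLin A) ^ (k + 1 - (j : ℕ))) (y j).2.2
  have hf : ∀ j, Measurable (f j) := fun j =>
    ((Matrix.toEuclideanLin A) ^ (k + 1 - (j : ℕ))).continuous_of_finiteDimensional.measurable.comp
      (by fun_prop)
  have hl : Measurable fun y : Fin (k + 1) → Packet n =>
      (⟨lastReception y, Nat.lt_succ_of_le (lastReception_le y)⟩ : Fin (k + 1)) := by
    refine measurable_to_countable' fun j => ?_
    have : (fun y : Fin (k + 1) → Packet n =>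
      (⟨lastReception y, Nat.lt_succ_of_le (lastReception_le y)⟩ : Fin (k + 1))) ⁻¹' {j} =
        lastReception ⁻¹' {(j : ℕ)} := by
      ext y
      simp [Fin.ext_iff]
    rw [this]
    exact measurable_lastReception (measurableSet_singleton _)
  have hu : Measurable fun p : Fin (k + 1) × (Fin (k + 1) → Packet n) => f p.1 p.2 :=
    measurable_from_prod_countable_right hf
  exact hu.comp (hl.prodMk measurable_id)

end Receiver

/-! ### Arrivals, transmissions and truncated records. -/

namespace Primitives

variable {n m : ℕ} {Ω : Type*}

section
variable (s : Primitives n m Ω)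

lemma measurable_channel_sigmaOn (k : ℕ) : Measurable[s.sigmaOn channelSources] (s.γ k) :=
  (comap_measurable (s.γ k)).mono
    (s.sigma_le_sigmaOn (i := .channel k) ⟨k, Or.inl rfl⟩) le_rfl

lemma measurable_tap_sigmaOn (k : ℕ) : Measurable[s.sigmaOn channelSources] (s.γe k) :=
  (comap_measurable (s.γe k)).mono
    (s.sigma_le_sigmaOn (i := .tap k) ⟨k, Or.inr rfl⟩) le_rfl

lemma channelSourcesBefore_subset (k : ℕ) : channelSourcesBefore k ⊆ channelSources :=
  fun _ ⟨l, _, h⟩ => ⟨l, h⟩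

lemma channelSourcesBefore_mono : Monotone channelSourcesBefore :=
  fun _ _ hjk _ ⟨l, hl, h⟩ => ⟨l, hl.trans_le hjk, h⟩

lemma measurable_tx_before (π : Policy) (k : ℕ) :
    Measurable[s.sigmaOn (channelSourcesBefore k)] (s.tx π k) := by
  have h : Measurable[s.sigmaOn (channelSourcesBefore k)]
      (fun ω (i : Fin k) => (s.γ i ω, s.γe i ω)) := by
    refine @measurable_pi_lambda _ _ _ (s.sigmaOn (channelSourcesBefore k)) _ _ fun i => ?_
    refine Measurable.prodMk ?_ ?_
    · exact (comap_measurable (s.γ i)).mono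
        (s.sigma_le_sigmaOn (i := .channel i) ⟨i, i.2, Or.inl rfl⟩) le_rfl
    · exact (comap_measurable (s.γe i)).mono
        (s.sigma_le_sigmaOn (i := .tap i) ⟨i, i.2, Or.inr rfl⟩) le_rfl
  exact (Measurable.of_discrete (f := π k)).comp h

lemma measurable_tx_sigmaOn (π : Policy) (k : ℕ) :
    Measurable[s.sigmaOn channelSources] (s.tx π k) :=
  (s.measurable_tx_before π k).mono (s.sigmaOn_mono (channelSourcesBefore_subset k)) le_rfl

lemma measurable_arrives_sigmaOn (π : Policy) {ch : ℕ → Ω → Bool}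
    (hch : ∀ k, Measurable[s.sigmaOn channelSources] (ch k)) (k : ℕ) :
    Measurable[s.sigmaOn channelSources] (s.arrives π ch k) := by
  by_cases hk : k = 0
  · have : s.arrives π ch k = fun _ => true := by
      ext ω
      simp [arrives, hk]
    rw [this]
    exact @measurable_const _ _ _ (s.sigmaOn channelSources) _
  · have : s.arrives π ch k = fun ω => (fun p : Bool × Bool => p.1 && p.2) (s.tx π k ω, ch k ω) := by
      ext ω
      simp [arrives, hk]
    rw [this]
    exact (Measurable.of_discrete (f := fun p : Bool × Bool => p.1 && p.2)).comp
      ((s.measurable_tx_sigmaOn π k).prodMk (hch k))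

lemma arrives_zero (π : Policy) (ch : ℕ → Ω → Bool) (ω : Ω) : s.arrives π ch 0 ω = true := by
  simp [arrives]

lemma arrives_succ (π : Policy) (ch : ℕ → Ω → Bool) (k : ℕ) (ω : Ω) :
    s.arrives π ch (k + 1) ω = (s.tx π (k + 1) ω && ch (k + 1) ω) := by
  simp [arrives]

/-- The time of the last reception up to time `k`. -/
def lastArrival (π : Policy) (ch : ℕ → Ω → Bool) (k : ℕ) (ω : Ω) : ℕ :=
  lastTrue (fun i => s.arrives π ch i ω) k

/-- The time of the last transmission up to time `k`. -/
def lastTx (π : Policy) (k : ℕ) (ω : Ω) : ℕ :=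
  lastTrue (fun i => s.tx π i ω) k

lemma lastArrival_le (π : Policy) (ch : ℕ → Ω → Bool) (k : ℕ) (ω : Ω) :
    s.lastArrival π ch k ω ≤ k := lastTrue_le _ _

lemma lastTx_le (π : Policy) (k : ℕ) (ω : Ω) : s.lastTx π k ω ≤ k := lastTrue_le _ _

lemma lastArrival_le_lastTx (π : Policy) (ch : ℕ → Ω → Bool) (k : ℕ) (ω : Ω) :
    s.lastArrival π ch k ω ≤ s.lastTx π k ω := by
  refine lastTrue_mono (fun i hi h => ?_) k
  obtain ⟨i, rfl⟩ := Nat.exists_eq_succ_of_ne_zero hi.ne'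
  rw [arrives_succ, Bool.and_eq_true] at h
  exact h.1

lemma measurable_lastArrival_sigmaOn (π : Policy) {ch : ℕ → Ω → Bool}
    (hch : ∀ k, Measurable[s.sigmaOn channelSources] (ch k)) (k : ℕ) :
    Measurable[s.sigmaOn channelSources] (s.lastArrival π ch k) :=
  @measurable_lastTrue _ (s.sigmaOn channelSources) _ _
    fun i _ => s.measurable_arrives_sigmaOn π hch i

/-- The decision at time k is settled by outcomes strictly before k. This makes the time of the last
transmission up to k independent of the channels at time k. -/
lemma measurable_lastTx_before (π : Policy) (k : ℕ) :
    Measurable[s.sigmaOn (channelSourcesBefore k)] (s.lastTx π k) :=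
  @measurable_lastTrue _ (s.sigmaOn (channelSourcesBefore k)) _ _ fun i hi =>
    (s.measurable_tx_before π i).mono (s.sigmaOn_mono (channelSourcesBefore_mono hi)) le_rfl

end

section
variable [mΩ : MeasurableSpace Ω] (s : Primitives n m Ω) (μ : Measure Ω)
  (A : Matrix (Fin n) (Fin n) ℝ) (C : Matrix (Fin m) (Fin n) ℝ) (π : Policy) (ch : ℕ → Ω → Bool)

lemma lastReception_past (k : ℕ) (ω : Ω) :
    lastReception (s.past μ A C π ch (k + 1) ω) = s.lastArrival π ch k ω :=
  lastTrue_congr fun i hi => by simp [Nat.lt_succ_of_le hi, past, obs]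

lemma recordPrediction_past (k : ℕ) (ω : Ω) :
    recordPrediction A (s.past μ A C π ch (k + 1) ω) =
      ((Matrix.toEuclideanLin A) ^ (k + 1 - s.lastArrival π ch k ω))
        (s.localEst μ A C (s.lastArrival π ch k ω) ω) := by
  have h : s.arrives π ch (s.lastArrival π ch k ω) ω = true :=
    lastTrue_eq_true (b := fun i => s.arrives π ch i ω) (s.arrives_zero π ch ω) k
  have key : ∀ j (hj : j < k + 1), j = s.lastArrival π ch k ω →
      ((Matrix.toEuclideanLin A) ^ (k + 1 - j)) (s.past μ A C π ch (k + 1) ω ⟨j, hj⟩).2.2 =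
        ((Matrix.toEuclideanLin A) ^ (k + 1 - s.lastArrival π ch k ω))
          (s.localEst μ A C (s.lastArrival π ch k ω) ω) := by
    rintro j hj rfl
    simp [past, obs, h]
  exact key _ _ (s.lastReception_past μ A C π ch k ω)

/-- The record of a receiver without the estimates received after time `j`. -/
noncomputable def truncatedPast (j k : ℕ) (ω : Ω) : Fin k → Packet n := fun i =>
  (s.tx π i ω, s.arrives π ch i ω,
    if (i : ℕ) ≤ j then (if s.arrives π ch i ω then s.localEst μ A C i ω else 0) else 0)

variable {s μ A C π ch}

/-- When nothing arrives after time j, the truncated entries already hold the default value zero. -/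
lemma truncatedPast_eq_past {j k : ℕ} {ω : Ω}
    (h : ∀ i, j < i → i < k → s.arrives π ch i ω = false) :
    s.truncatedPast μ A C π ch j k ω = s.past μ A C π ch k ω := by
  funext i
  by_cases hi : (i : ℕ) ≤ j
  · simp [truncatedPast, past, obs, hi]
  · simp [truncatedPast, past, obs, hi, h i (not_le.1 hi) i.2]

/-- Unlike the full record, the truncated one uses no measurement after time j, so it is independent
of the prediction error started at j. -/
lemma measurable_truncatedPast (hch : ∀ k, Measurable[s.sigmaOn channelSources] (ch k))
    (j k : ℕ) : Measurable[s.fullInfo A C j] (s.truncatedPast μ A C π ch j k) := by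
  have hle : s.sigmaOn channelSources ≤ s.fullInfo A C j := le_sup_right
  refine @measurable_pi_lambda _ _ _ (s.fullInfo A C j) _ _ fun i => ?_
  have harr : Measurable[s.fullInfo A C j] (s.arrives π ch i) :=
    (s.measurable_arrives_sigmaOn π hch i).mono hle le_rfl
  refine Measurable.prodMk ((s.measurable_tx_sigmaOn π i).mono hle le_rfl)
    (Measurable.prodMk harr ?_)
  by_cases hi : (i : ℕ) ≤ j
  · simp only [hi, if_true]
    refine Measurable.ite (harr (measurableSet_singleton true)) ?_
      (@measurable_const _ _ _ (s.fullInfo A C j) _)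
    exact (s.measurable_localEst_sensorInfo μ A C i).mono
      ((s.sensorInfo_mono A C hi).trans le_sup_left) le_rfl
  · simp only [hi, if_false]
    exact @measurable_const _ _ _ (s.fullInfo A C j) _

namespace IsModel

variable {Q : Matrix (Fin n) (Fin n) ℝ} {R : Matrix (Fin m) (Fin m) ℝ}
  {Pbar : Matrix (Fin n) (Fin n) ℝ} {lam lamE : ℝ}

lemma measurable_tx (h : s.IsModel μ A C Q R Pbar lam lamE) (k : ℕ) : Measurable (s.tx π k) :=
  (s.measurable_tx_sigmaOn π k).mono (h.sigmaOn_le _) le_rfl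

lemma measurable_arrives (h : s.IsModel μ A C Q R Pbar lam lamE)
    (hch : ∀ k, Measurable[s.sigmaOn channelSources] (ch k)) (k : ℕ) :
    Measurable (s.arrives π ch k) :=
  (s.measurable_arrives_sigmaOn π hch k).mono (h.sigmaOn_le _) le_rfl

lemma measurable_obs (h : s.IsModel μ A C Q R Pbar lam lamE)
    (hch : ∀ k, Measurable[s.sigmaOn channelSources] (ch k)) (k : ℕ) :
    Measurable (s.obs μ A C π ch k) :=
  (h.measurable_tx k).prodMk ((h.measurable_arrives hch k).prodMk
    (Measurable.ite (h.measurable_arrives hch k (measurableSet_singleton true))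
      (h.measurable_localEst k) measurable_const))

lemma measurable_past (h : s.IsModel μ A C Q R Pbar lam lamE)
    (hch : ∀ k, Measurable[s.sigmaOn channelSources] (ch k)) (k : ℕ) :
    Measurable (s.past μ A C π ch k) :=
  measurable_pi_lambda _ fun i => h.measurable_obs hch i

variable [IsProbabilityMeasure μ]

/-- Given no reception after time `j`, the prediction error from time `j` is independent of the
record. -/
lemma setLIntegral_past_state (h : s.IsModel μ A C Q R Pbar lam lamE)
    (hch : ∀ k, Measurable[s.sigmaOn channelSources] (ch k)) {j t k l : ℕ} (hjt : j + t = l)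
    {B : Set Ω} (hB : MeasurableSet[s.sigmaOn channelSources] B)
    (hno : ∀ ω ∈ B, ∀ i, j < i → i < k → s.arrives π ch i ω = false)
    {F : (Fin k → Packet n) × Vec n → ENNReal} (hF : Measurable F) :
    ∫⁻ ω in B, F (s.past μ A C π ch k ω, s.state A l ω) ∂μ =
      ∫⁻ ω in B, ∫⁻ r, F (s.past μ A C π ch k ω,
        ((Matrix.toEuclideanLin A) ^ t) (s.localEst μ A C j ω) + r)
          ∂(μ.map (s.predErr μ A C j t)) ∂μ := by
  subst hjt
  have hB' : MeasurableSet B := h.sigmaOn_le _ _ hB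
  -- The indicator of B travels as a coordinate of T, so that independence is applied on the whole
  -- space instead of on B.
  let T : Ω → ENNReal × (Fin k → Packet n) × Vec n := fun ω =>
    (B.indicator (fun _ => 1) ω, s.truncatedPast μ A C π ch j k ω,
      ((Matrix.toEuclideanLin A) ^ t) (s.localEst μ A C j ω))
  have hT : Measurable[s.fullInfo A C j] T := by
    have hle : s.sigmaOn channelSources ≤ s.fullInfo A C j := le_sup_right
    refine Measurable.prodMk ?_ (Measurable.prodMk (measurable_truncatedPast hch j k) ?_)
    · exact (@measurable_const _ _ _ (s.fullInfo A C j) _).indicator (hle _ hB)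
    · exact ((Matrix.toEuclideanLin A) ^ t).continuous_of_finiteDimensional.measurable.comp
        ((s.measurable_localEst_sensorInfo μ A C j).mono le_sup_left le_rfl)
  let F' : (ENNReal × (Fin k → Packet n) × Vec n) × Vec n → ENNReal := fun p =>
    p.1.1 * F (p.1.2.1, p.1.2.2 + p.2)
  have hF' : Measurable F' := by fun_prop
  have key := lintegral_comp_of_indep (h.fullInfo_le j) (h.measurable_predErr j t) hT
    (h.indep_predErr j t) hF'
  rw [← lintegral_indicator hB', ← lintegral_indicator hB']
  refine Eq.trans (lintegral_congr fun ω => ?_) (key.trans (lintegral_congr fun ω => ?_))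
  · by_cases hω : ω ∈ B
    · simp [F', T, hω, truncatedPast_eq_past (hno ω hω), predErr]
    · simp [F', T, hω]
  · by_cases hω : ω ∈ B
    · simp [F', T, hω, truncatedPast_eq_past (hno ω hω)]
    · simp [F', T, hω]

end IsModel

end

end Primitives

/-! ### The conditional law of the state and the information in one packet. -/

namespace Primitives

variable {n m : ℕ} {Ω : Type*} [mΩ : MeasurableSpace Ω]

/-- The conditional law of the state at time `k + 1` given the record up to time `k`. -/
noncomputable def stateKernel (s : Primitives n m Ω) (μ : Measure Ω)
    (A : Matrix (Fin n) (Fin n) ℝ) (C : Matrix (Fin m) (Fin n) ℝ) (k : ℕ) :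
    Kernel (Fin (k + 1) → Packet n) (Vec n) :=
  (Kernel.id ×ₖ (Kernel.ofFunOfCountable
    fun j => μ.map (s.predErr μ A C j (k + 1 - j))).comap lastReception
      measurable_lastReception).map fun p => recordPrediction A p.1 + p.2

namespace IsModel

variable {s : Primitives n m Ω} {μ : Measure Ω} [IsProbabilityMeasure μ]
  {A : Matrix (Fin n) (Fin n) ℝ} {C : Matrix (Fin m) (Fin n) ℝ} {Q : Matrix (Fin n) (Fin n) ℝ}
  {R : Matrix (Fin m) (Fin m) ℝ} {Pbar : Matrix (Fin n) (Fin n) ℝ} {lam lamE : ℝ} {π : Policy}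
  {ch : ℕ → Ω → Bool}

lemma isMarkovKernel_predErr (h : s.IsModel μ A C Q R Pbar lam lamE) (k : ℕ) :
    IsMarkovKernel (Kernel.ofFunOfCountable
      fun j => μ.map (s.predErr μ A C j (k + 1 - j))) :=
  ⟨fun j => Measure.isProbabilityMeasure_map (h.measurable_predErr j _).aemeasurable⟩

lemma isMarkovKernel_stateKernel (h : s.IsModel μ A C Q R Pbar lam lamE) (k : ℕ) :
    IsMarkovKernel (s.stateKernel μ A C k) := by
  have := h.isMarkovKernel_predErr k
  exact Kernel.IsMarkovKernel.map _
    (((measurable_recordPrediction A).comp measurable_fst).add measurable_snd)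

lemma lintegral_stateKernel (h : s.IsModel μ A C Q R Pbar lam lamE) (k : ℕ)
    (y : Fin (k + 1) → Packet n) {f : Vec n → ENNReal} (hf : Measurable f) :
    ∫⁻ x, f x ∂(s.stateKernel μ A C k y) = ∫⁻ r, f (recordPrediction A y + r)
      ∂(μ.map (s.predErr μ A C (lastReception y) (k + 1 - lastReception y))) := by
  have := h.isMarkovKernel_predErr k
  have hm : Measurable fun p : (Fin (k + 1) → Packet n) × Vec n =>
      recordPrediction A p.1 + p.2 :=
    ((measurable_recordPrediction A).comp measurable_fst).add measurable_snd
  rw [stateKernel, Kernel.lintegral_map _ hm _ hf]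
  exact Kernel.lintegral_id_prod (hf.comp hm) _ y

/-- On each fibre of the last reception time the state is a prediction readable from the record plus
an error whose law depends on that time only. This identifies the conditional distribution of the
state. -/
lemma map_past_state (h : s.IsModel μ A C Q R Pbar lam lamE)
    (hch : ∀ k, Measurable[s.sigmaOn channelSources] (ch k)) (k : ℕ) :
    μ.map (fun ω => (s.past μ A C π ch (k + 1) ω, s.state A (k + 1) ω)) =
      (μ.map (s.past μ A C π ch (k + 1))) ⊗ₘ (s.stateKernel μ A C k) := by
  have := h.isMarkovKernel_stateKernel k
  have hY := h.measurable_past (π := π) hch (k + 1)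
  have hN := s.measurable_lastArrival_sigmaOn π hch k
  refine Measure.ext_of_lintegral _ fun F hF => ?_
  rw [lintegral_map hF (hY.prodMk (h.measurable_state (k + 1))), Measure.lintegral_compProd hF,
    lintegral_map hF.lintegral_kernel_prod_right' hY,
    lintegral_eq_sum_fiber (hN.mono (h.sigmaOn_le _) le_rfl) (s.lastArrival_le π ch k),
    lintegral_eq_sum_fiber (hN.mono (h.sigmaOn_le _) le_rfl) (s.lastArrival_le π ch k)]
  refine Finset.sum_congr rfl fun j hj => ?_
  have hj : j ≤ k := Nat.le_of_lt_succ (Finset.mem_range.1 hj)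
  have hB : MeasurableSet[s.sigmaOn channelSources] {ω | s.lastArrival π ch k ω = j} :=
    hN (measurableSet_singleton j)
  rw [h.setLIntegral_past_state hch (j := j) (t := k + 1 - j) (by omega) hB ?_ hF]
  · refine setLIntegral_congr_fun (h.sigmaOn_le _ _ hB) fun ω hω => ?_
    have hω : s.lastArrival π ch k ω = j := hω
    have hFy : Measurable fun x => F (s.past μ A C π ch (k + 1) ω, x) :=
      hF.comp measurable_prodMk_left
    rw [h.lintegral_stateKernel k _ hFy, s.recordPrediction_past,
      s.lastReception_past, hω]
  · rintro ω rfl i hi hik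
    exact eq_false_of_lastTrue_lt _ hi (Nat.le_of_lt_succ hik)

lemma condDistrib_state_past (h : s.IsModel μ A C Q R Pbar lam lamE)
    (hch : ∀ k, Measurable[s.sigmaOn channelSources] (ch k)) (k : ℕ) :
    condDistrib (s.state A (k + 1)) (s.past μ A C π ch (k + 1)) μ
      =ᵐ[μ.map (s.past μ A C π ch (k + 1))] s.stateKernel μ A C k :=
  have := h.isMarkovKernel_stateKernel k
  condDistrib_ae_eq_of_measure_eq_compProd _ (h.measurable_state (k + 1)).aemeasurable
    (h.map_past_state hch k)

/-- A test function with small exponential moment under the conditional law of the state bounds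
the conditional mutual information from below. -/
lemma ofReal_integral_le_condMutualInfo (h : s.IsModel μ A C Q R Pbar lam lamE)
    (hch : ∀ k, Measurable[s.sigmaOn channelSources] (ch k)) (k : ℕ)
    {φ : (Fin (k + 1) → Packet n) × Vec n × Packet n → ℝ} (hφ : Measurable φ)
    (hint : Integrable (fun ω => φ (s.past μ A C π ch (k + 1) ω, s.state A (k + 1) ω,
      s.obs μ A C π ch (k + 1) ω)) μ)
    (hexp : ∀ y z, ∫⁻ x, ENNReal.ofReal (Real.exp (φ (y, x, z))) ∂(s.stateKernel μ A C k y) ≤ 1) :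
    ENNReal.ofReal (∫ ω, φ (s.past μ A C π ch (k + 1) ω, s.state A (k + 1) ω,
      s.obs μ A C π ch (k + 1) ω) ∂μ) ≤
    condMutualInfo μ (s.state A (k + 1)) (s.obs μ A C π ch (k + 1))
      (s.past μ A C π ch (k + 1)) := by
  have hY := h.measurable_past (π := π) hch (k + 1)
  have hX := h.measurable_state (k + 1)
  have hZ := h.measurable_obs (π := π) hch (k + 1)
  have := h.isMarkovKernel_stateKernel k
  have hYXZ : Measurable fun ω => (s.past μ A C π ch (k + 1) ω, s.state A (k + 1) ω,
      s.obs μ A C π ch (k + 1) ω) := hY.prodMk (hX.prodMk hZ)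
  have := Measure.isProbabilityMeasure_map (μ := μ) hYXZ.aemeasurable
  have := Measure.isProbabilityMeasure_map (μ := μ) hY.aemeasurable
  have hg : Measurable fun p => ENNReal.ofReal (Real.exp (φ p)) :=
    (Real.measurable_exp.comp hφ).ennreal_ofReal
  rw [condMutualInfo, ← integral_map (f := φ) hYXZ.aemeasurable hφ.aestronglyMeasurable]
  refine ofReal_integral_le_klDiv hφ ?_ ?_
  · exact (integrable_map_measure hφ.aestronglyMeasurable hYXZ.aemeasurable).2 hint
  · rw [Measure.lintegral_compProd hg]
    refine (lintegral_mono_ae (g := fun _ => 1) ?_).trans (by simp)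
    filter_upwards [h.condDistrib_state_past (π := π) hch k] with y hy
    have hgy : Measurable fun b => ENNReal.ofReal (Real.exp (φ (y, b))) :=
      hg.comp measurable_prodMk_left
    -- Integrating over the state first, with the packet z fixed, gives a bound uniform in z, so the
    -- conditional law of the packet need not be known.
    rw [Kernel.lintegral_prod _ _ _ hgy, hy, lintegral_lintegral_swap hgy.aemeasurable]
    refine (lintegral_mono fun z => hexp y z).trans (by simp)

/-- The test function comparing, in the directions `u`, the two Gaussian laws of the state
with and without the new packet. -/
noncomputable def testFun (A : Matrix (Fin n) (Fin n) ℝ) (ρ : ℝ) (V : ℕ → ℝ) (u : ℕ → Vec n)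
    (k : ℕ) (p : (Fin (k + 1) → Packet n) × Vec n × Packet n) : ℝ :=
  if p.2.2.2.1 then
    (1 / 2 * Real.log ρ) * ((k + 1 - lastReception p.1 : ℕ) : ℝ) -
      (inner ℝ (u (k + 1 - lastReception p.1)) (p.2.1 - p.2.2.2.2)) ^ 2 /
        (2 * (V (k + 1 - lastReception p.1) / ρ ^ (k + 1 - lastReception p.1))) +
      (inner ℝ (u (k + 1 - lastReception p.1)) (p.2.1 - recordPrediction A p.1)) ^ 2 /
        (2 * V (k + 1 - lastReception p.1))
  else 0

omit mΩ in
lemma measurable_testFun (ρ : ℝ) (V : ℕ → ℝ) (u : ℕ → Vec n) (k : ℕ) :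
    Measurable (testFun A ρ V u k) := by
  have hl : Measurable fun p : (Fin (k + 1) → Packet n) × Vec n × Packet n =>
      k + 1 - lastReception p.1 :=
    measurable_const.sub (measurable_lastReception.comp measurable_fst)
  have hr : Measurable fun p : (Fin (k + 1) → Packet n) × Vec n × Packet n =>
      recordPrediction A p.1 := (measurable_recordPrediction A).comp measurable_fst
  have hu : Measurable fun p : (Fin (k + 1) → Packet n) × Vec n × Packet n =>
      u (k + 1 - lastReception p.1) := (Measurable.of_discrete (f := u)).comp hl
  have hV : Measurable fun p : (Fin (k + 1) → Packet n) × Vec n × Packet n =>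
      V (k + 1 - lastReception p.1) := (Measurable.of_discrete (f := V)).comp hl
  have hρ : Measurable fun p : (Fin (k + 1) → Packet n) × Vec n × Packet n =>
      ρ ^ (k + 1 - lastReception p.1) := (Measurable.of_discrete (f := fun t : ℕ => ρ ^ t)).comp hl
  have hc : Measurable fun p : (Fin (k + 1) → Packet n) × Vec n × Packet n =>
      ((k + 1 - lastReception p.1 : ℕ) : ℝ) :=
    (Measurable.of_discrete (f := fun t : ℕ => (t : ℝ))).comp hl
  refine Measurable.ite ?_ ?_ measurable_const
  · exact (measurable_fst.comp (measurable_snd.comp (measurable_snd.comp measurable_snd)))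
      (measurableSet_singleton true)
  · fun_prop

/-- Without a reception the test function is zero. With one, its exponential is a ratio of Gaussian
densities with variances V/ρ^t and V. The variance V/ρ^t stands in for that of `Pbar`, which may
vanish in the direction used. -/
lemma lintegral_exp_testFun_le (h : s.IsModel μ A C Q R Pbar lam lamE) (hQ : Q.PosDef)
    {ρ : ℝ} (hρ : 0 < ρ) {u : ℕ → Vec n}
    (hu : ∀ t, 0 < t → 0 < predVar A Q Pbar t (u t)) (k : ℕ)
    (y : Fin (k + 1) → Packet n) (z : Packet n) :
    ∫⁻ x, ENNReal.ofReal (Real.exp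
      (testFun A ρ (fun t => predVar A Q Pbar t (u t)) u k (y, x, z)))
      ∂(s.stateKernel μ A C k y) ≤ 1 := by
  have := h.isMarkovKernel_stateKernel k
  by_cases hz : z.2.1 = true
  swap; · simp [testFun, hz]
  have hg : Measurable fun x => ENNReal.ofReal (Real.exp
      (testFun A ρ (fun t => predVar A Q Pbar t (u t)) u k (y, x, z))) := by
    have := (measurable_testFun (A := A) ρ (fun t => predVar A Q Pbar t (u t)) u k).comp
      (f := fun x : Vec n => (y, x, z)) (by fun_prop)
    exact (Real.measurable_exp.comp this).ennreal_ofReal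
  rw [h.lintegral_stateKernel k y hg]
  simp only [testFun, hz, if_true, add_sub_cancel_left]
  set t := k + 1 - lastReception y with ht
  have htpos : 0 < t := by
    have := lastReception_le y
    omega
  have hs := hu t htpos
  set V := predVar A Q Pbar t (u t) with hV
  set c : ℝ := inner ℝ (u t) (z.2.2 - recordPrediction A y) with hc
  have hσ : 0 < V / ρ ^ t := by positivity
  have key := lintegral_exp_gaussian_ratio hσ hs (a := (1 / 2 * Real.log ρ) * (t : ℝ)) (by
    rw [div_div_cancel₀ hs.ne', Real.log_pow]
    ring) c
  rw [hV, ← h.map_inner_predErr hQ (lastReception y) t (u t), ← hV,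
    lintegral_map (by fun_prop) (by
      have := h.measurable_predErr (lastReception y) t
      fun_prop)] at key
  rw [lintegral_map (by fun_prop) (h.measurable_predErr _ _)]
  refine le_of_eq (Eq.trans (lintegral_congr fun ω => ?_) key)
  have : (inner ℝ (u t) (recordPrediction A y + s.predErr μ A C (lastReception y) t ω - z.2.2) : ℝ)
      = inner ℝ (u t) (s.predErr μ A C (lastReception y) t ω) - c := by
    rw [hc, ← inner_sub_right]
    congr 1
    abel
  rw [this]

lemma integrable_inner_predErr_sq (h : s.IsModel μ A C Q R Pbar lam lamE) (hQ : Q.PosDef)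
    (j t : ℕ) (u : Vec n) :
    Integrable (fun ω => (inner ℝ u (s.predErr μ A C j t ω) : ℝ) ^ 2) μ := by
  have hm : Measurable fun ω => (inner ℝ u (s.predErr μ A C j t ω) : ℝ) := by
    have := h.measurable_predErr j t
    fun_prop
  have := integrable_sq_gaussianReal (predVar A Q Pbar t u).toNNReal
  rw [← h.map_inner_predErr hQ j t u, integrable_map_measure (by fun_prop) hm.aemeasurable] at this
  exact this

lemma integral_inner_predErr_sq (h : s.IsModel μ A C Q R Pbar lam lamE) (hQ : Q.PosDef)
    (j t : ℕ) (u : Vec n) :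
    ∫ ω, (inner ℝ u (s.predErr μ A C j t ω) : ℝ) ^ 2 ∂μ = predVar A Q Pbar t u := by
  have hm : Measurable fun ω => (inner ℝ u (s.predErr μ A C j t ω) : ℝ) := by
    have := h.measurable_predErr j t
    fun_prop
  have := integral_sq_gaussianReal (predVar A Q Pbar t u).toNNReal
  rw [← h.map_inner_predErr hQ j t u, integral_map hm.aemeasurable (by fun_prop)] at this
  rw [this, Real.coe_toNNReal _ (predVar_nonneg hQ h.quadForm_nonneg t u)]

lemma setIntegral_inner_predErr_sq (h : s.IsModel μ A C Q R Pbar lam lamE) (hQ : Q.PosDef)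
    (j t : ℕ) (u : Vec n) {B : Set Ω} (hB : MeasurableSet[s.sigmaOn channelSources] B) :
    ∫ ω in B, (inner ℝ u (s.predErr μ A C j t ω) : ℝ) ^ 2 ∂μ =
      μ.real B * predVar A Q Pbar t u := by
  have hm : Measurable fun x : Vec n => (inner ℝ u x : ℝ) ^ 2 := by fun_prop
  rw [← h.integral_inner_predErr_sq hQ j t u]
  refine setIntegral_of_indep (h.sigmaOn_le channelSources) (hm.comp (h.measurable_predErr j t))
    (indep_of_indep_of_le_left (indep_of_indep_of_le_right (h.indep_predErr j t)
      le_sup_right) ?_) hB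
  exact (hm.comp (comap_measurable (s.predErr μ A C j t))).comap_le

/-- The information revealed by a packet grows linearly in the time since the last reception. -/
lemma ofReal_le_condMutualInfo (h : s.IsModel μ A C Q R Pbar lam lamE) (hQ : Q.PosDef)
    (hch : ∀ k, Measurable[s.sigmaOn channelSources] (ch k))
    {ρ : ℝ} (hρ : 1 < ρ) {u : ℕ → Vec n}
    (hu : ∀ t, 0 < t → ρ ^ t * quadForm Pbar (u t) < predVar A Q Pbar t (u t)) (k : ℕ) :
    ENNReal.ofReal (1 / 2 * Real.log ρ * ∫ ω, (if s.arrives π ch (k + 1) ω then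
      ((k + 1 - s.lastArrival π ch k ω : ℕ) : ℝ) else 0) ∂μ) ≤
    condMutualInfo μ (s.state A (k + 1)) (s.obs μ A C π ch (k + 1))
      (s.past μ A C π ch (k + 1)) := by
  have hρ0 : 0 < ρ := zero_lt_one.trans hρ
  have hu' : ∀ t, 0 < t → 0 < predVar A Q Pbar t (u t) := fun t ht =>
    (mul_nonneg (by positivity) (h.quadForm_nonneg _)).trans_lt (hu t ht)
  let V : ℕ → ℝ := fun t => predVar A Q Pbar t (u t)
  let N := s.lastArrival π ch k
  have hN := s.measurable_lastArrival_sigmaOn π hch k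
  have harr := s.measurable_arrives_sigmaOn π hch (k + 1)
  let S : Set Ω := {ω | s.arrives π ch (k + 1) ω = true}
  have hS : MeasurableSet[s.sigmaOn channelSources] S := harr (measurableSet_singleton true)
  let f : Ω → ℝ := fun ω => testFun A ρ V u k (s.past μ A C π ch (k + 1) ω, s.state A (k + 1) ω,
      s.obs μ A C π ch (k + 1) ω)
  -- The test function on a reception whose predecessor was at time j: the state minus the packet is
  -- the sensor's current error, the state minus the prediction is the error accumulated since j.
  let g : ℕ → Ω → ℝ := fun j ω => (1 / 2 * Real.log ρ) * ((k + 1 - j : ℕ) : ℝ) -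
    (inner ℝ (u (k + 1 - j)) (s.predErr μ A C (k + 1) 0 ω)) ^ 2 /
      (2 * (V (k + 1 - j) / ρ ^ (k + 1 - j))) +
    (inner ℝ (u (k + 1 - j)) (s.predErr μ A C j (k + 1 - j) ω)) ^ 2 / (2 * V (k + 1 - j))
  have hg : ∀ j, Integrable (g j) μ := fun j =>
    ((integrable_const _).sub ((h.integrable_inner_predErr_sq hQ _ _ _).div_const _)).add
      ((h.integrable_inner_predErr_sq hQ _ _ _).div_const _)
  have hfg : ∀ j ≤ k, ∀ ω ∈ {ω | N ω = j}, f ω = S.indicator (g j) ω := by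
    rintro j hj ω hω
    have hω : s.lastArrival π ch k ω = j := hω
    by_cases ha : s.arrives π ch (k + 1) ω = true
    · have hmem : ω ∈ S := ha
      rw [Set.indicator_of_mem hmem]
      have he : s.predErr μ A C j (k + 1 - j) ω = s.state A (k + 1) ω -
          ((Matrix.toEuclideanLin A) ^ (k + 1 - j)) (s.localEst μ A C j ω) := by
        rw [predErr, Nat.add_sub_of_le (hj.trans k.le_succ)]
      simp only [f, g, testFun, s.recordPrediction_past, s.lastReception_past, hω, he]
      simp [obs, ha, predErr]
    · have hmem : ω ∉ S := ha
      rw [Set.indicator_of_notMem hmem]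
      simp [f, testFun, obs, ha]
  have hfi : ∀ j ≤ k, IntegrableOn f {ω | N ω = j} μ := fun j hj =>
    (((hg j).indicator (h.sigmaOn_le _ _ hS)).integrableOn).congr_fun
      (fun ω hω => (hfg j hj ω hω).symm) (h.sigmaOn_le _ _ (hN (measurableSet_singleton j)))
  refine le_trans (ENNReal.ofReal_le_ofReal ?_) (h.ofReal_integral_le_condMutualInfo (π := π) hch k
    (measurable_testFun (A := A) ρ V u k)
    (integrable_of_fiber (s.lastArrival_le π ch k) hfi)
    (h.lintegral_exp_testFun_le hQ hρ0 hu' k))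
  have hN' := hN.mono (h.sigmaOn_le _) le_rfl
  change _ ≤ ∫ ω, f ω ∂μ
  rw [integral_eq_sum_fiber hN' (s.lastArrival_le π ch k) hfi, ← integral_const_mul]
  have hconst : ∀ j ≤ k, ∀ ω ∈ {ω | N ω = j}, 1 / 2 * Real.log ρ *
      (if s.arrives π ch (k + 1) ω then ((k + 1 - s.lastArrival π ch k ω : ℕ) : ℝ) else 0) =
      S.indicator (fun _ => 1 / 2 * Real.log ρ * ((k + 1 - j : ℕ) : ℝ)) ω := by
    rintro j hj ω hω
    have hω : s.lastArrival π ch k ω = j := hω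
    by_cases ha : s.arrives π ch (k + 1) ω = true
    · have hmem : ω ∈ S := ha
      simp [hmem, ha, hω]
    · have hmem : ω ∉ S := ha
      simp [hmem, ha]
  have hconsti : ∀ j ≤ k, IntegrableOn (fun ω => 1 / 2 * Real.log ρ *
      (if s.arrives π ch (k + 1) ω then ((k + 1 - s.lastArrival π ch k ω : ℕ) : ℝ) else 0))
      {ω | N ω = j} μ := fun j hj =>
    (((integrable_const (μ := μ) (1 / 2 * Real.log ρ * ((k + 1 - j : ℕ) : ℝ))).indicator
      (h.sigmaOn_le _ _ hS)).integrableOn).congr_fun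
      (fun ω hω => (hconst j hj ω hω).symm) (h.sigmaOn_le _ _ (hN (measurableSet_singleton j)))
  rw [integral_eq_sum_fiber hN' (s.lastArrival_le π ch k) hconsti]
  refine Finset.sum_le_sum fun j hj => ?_
  have hj : j ≤ k := Nat.le_of_lt_succ (Finset.mem_range.1 hj)
  have hBj : MeasurableSet[s.sigmaOn channelSources] {ω | N ω = j} := hN (measurableSet_singleton j)
  have hBS : MeasurableSet[s.sigmaOn channelSources] ({ω | N ω = j} ∩ S) :=
    MeasurableSet.inter hBj hS
  rw [setIntegral_congr_fun (h.sigmaOn_le _ _ hBj) (hconst j hj),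
    setIntegral_congr_fun (h.sigmaOn_le _ _ hBj) (hfg j hj),
    setIntegral_indicator (h.sigmaOn_le _ _ hS), setIntegral_indicator (h.sigmaOn_le _ _ hS),
    setIntegral_const, smul_eq_mul]
  set t := k + 1 - j with ht
  have htpos : 0 < t := by omega
  have hi1 := (h.integrable_inner_predErr_sq hQ (k + 1) 0 (u t)).div_const
    (2 * (V t / ρ ^ t))
  have hi2 := (h.integrable_inner_predErr_sq hQ j t (u t)).div_const (2 * V t)
  have hval : ∫ ω in {ω | N ω = j} ∩ S, g j ω ∂μ = μ.real ({ω | N ω = j} ∩ S) *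
      (1 / 2 * Real.log ρ * (t : ℝ)) -
      μ.real ({ω | N ω = j} ∩ S) * predVar A Q Pbar 0 (u t) / (2 * (V t / ρ ^ t)) +
      μ.real ({ω | N ω = j} ∩ S) * predVar A Q Pbar t (u t) / (2 * V t) := by
    rw [← h.setIntegral_inner_predErr_sq hQ (k + 1) 0 (u t) hBS,
      ← h.setIntegral_inner_predErr_sq hQ j t (u t) hBS, ← integral_div, ← integral_div,
      ← smul_eq_mul, ← setIntegral_const,
      ← integral_sub (integrable_const _) hi1.integrableOn, ← integral_add ?_ hi2.integrableOn]
    exact (integrable_const _).sub hi1.integrableOn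
  rw [hval]
  have hVt : 0 < V t := hu' t htpos
  have hp : 0 < ρ ^ t := by positivity
  -- By the choice of `u t`, the subtracted quadratic term has mean at most 1/2 and the added one
  -- exactly 1/2, so at least t · ½ log ρ is left.
  have h1 : predVar A Q Pbar 0 (u t) / (2 * (V t / ρ ^ t)) ≤ 1 / 2 := by
    rw [div_le_iff₀ (by positivity)]
    have := hu t htpos
    rw [mul_comm, ← lt_div_iff₀ hp] at this
    simp only [predVar]
    linarith
  have h2 : predVar A Q Pbar t (u t) / (2 * V t) = 1 / 2 := by
    have : predVar A Q Pbar t (u t) = V t := rfl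
    rw [this]
    field_simp
  rw [mul_div_assoc, mul_div_assoc, h2]
  nlinarith [measureReal_nonneg (μ := μ) (s := {ω | N ω = j} ∩ S)]

end IsModel

end Primitives

/-! ### The remote error and the telescoping sum. -/

namespace Primitives.IsModel

variable {n m : ℕ} {Ω : Type*} [mΩ : MeasurableSpace Ω]
  {s : Primitives n m Ω} {μ : Measure Ω} [IsProbabilityMeasure μ]
  {A : Matrix (Fin n) (Fin n) ℝ} {C : Matrix (Fin m) (Fin n) ℝ} {Q : Matrix (Fin n) (Fin n) ℝ}
  {R : Matrix (Fin m) (Fin m) ℝ} {Pbar : Matrix (Fin n) (Fin n) ℝ} {lam lamE : ℝ} {π : Policy}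
  {ch : ℕ → Ω → Bool}

omit [IsProbabilityMeasure μ] in
lemma info_le (h : s.IsModel μ A C Q R Pbar lam lamE)
    (hch : ∀ k, Measurable[s.sigmaOn channelSources] (ch k)) (k : ℕ) :
    s.info μ A C π ch k ≤ mΩ :=
  (h.measurable_past hch (k + 1)).comap_le

/-- The mean square error of any receiver in a direction is at least the mean variance of the
prediction from its last reception. -/
lemma lintegral_predVar_le (h : s.IsModel μ A C Q R Pbar lam lamE) (hQ : Q.PosDef)
    (hch : ∀ k, Measurable[s.sigmaOn channelSources] (ch k)) (k : ℕ) (u : Vec n) :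
    ∫⁻ ω, ENNReal.ofReal (predVar A Q Pbar (k - s.lastArrival π ch k ω) u) ∂μ ≤
      ∫⁻ ω, ENNReal.ofReal
        ((inner ℝ u (s.state A k ω - (μ[s.state A k | s.info μ A C π ch k]) ω) : ℝ) ^ 2) ∂μ := by
  have hN := s.measurable_lastArrival_sigmaOn π hch k
  have hN' := hN.mono (h.sigmaOn_le _) le_rfl
  -- The estimate is a function of the record, hence fixed while the prediction error is integrated
  -- out; a fixed offset cannot lower the second moment of a centred Gaussian.
  obtain ⟨g, hg, hge⟩ : ∃ g, Measurable g ∧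
      (μ[s.state A k | s.info μ A C π ch k]) = g ∘ s.past μ A C π ch (k + 1) :=
    Measurable.exists_eq_measurable_comp
      (stronglyMeasurable_condExp (μ := μ) (m := s.info μ A C π ch k)
        (f := s.state A k)).measurable
  let F : (Fin (k + 1) → Packet n) × Vec n → ENNReal := fun p =>
    ENNReal.ofReal ((inner ℝ u (p.2 - g p.1) : ℝ) ^ 2)
  have hF : Measurable F := by fun_prop
  have hrw : ∀ ω, ENNReal.ofReal
      ((inner ℝ u (s.state A k ω - (μ[s.state A k | s.info μ A C π ch k]) ω) : ℝ) ^ 2) =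
      F (s.past μ A C π ch (k + 1) ω, s.state A k ω) := fun ω => by
    rw [hge]; rfl
  simp only [hrw]
  rw [lintegral_eq_sum_fiber hN' (s.lastArrival_le π ch k),
    lintegral_eq_sum_fiber hN' (s.lastArrival_le π ch k)]
  refine Finset.sum_le_sum fun j hj => ?_
  have hj : j ≤ k := Nat.le_of_lt_succ (Finset.mem_range.1 hj)
  have hB : MeasurableSet[s.sigmaOn channelSources] {ω | s.lastArrival π ch k ω = j} :=
    hN (measurableSet_singleton j)
  rw [h.setLIntegral_past_state hch (j := j) (t := k - j) (by omega) hB ?_ hF]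
  · refine setLIntegral_mono' (h.sigmaOn_le _ _ hB) fun ω hω => ?_
    have hω : s.lastArrival π ch k ω = j := hω
    rw [hω]
    have key := le_lintegral_sq_gaussianReal (predVar A Q Pbar (k - j) u).toNNReal
      (inner ℝ u (((Matrix.toEuclideanLin A) ^ (k - j)) (s.localEst μ A C j ω) -
        g (s.past μ A C π ch (k + 1) ω)))
    have hm := h.measurable_predErr j (k - j)
    rw [← h.map_inner_predErr hQ j (k - j) u, lintegral_map (by fun_prop) (by fun_prop)] at key
    rw [lintegral_map (by fun_prop) hm]
    refine key.trans (lintegral_mono fun ω' => le_of_eq ?_)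
    simp only [F]
    rw [← inner_add_right]
    congr 4
    abel
  · rintro ω rfl i hi hik
    exact eq_false_of_lastTrue_lt _ hi (Nat.le_of_lt_succ hik)

omit [IsProbabilityMeasure μ] in
lemma memLp_remoteErr (h : s.IsModel μ A C Q R Pbar lam lamE) (k : ℕ) :
    MemLp (fun ω => s.state A k ω - (μ[s.state A k | s.info μ A C π s.γ k]) ω) 2 μ :=
  (h.memLp_state k).sub ((h.memLp_state k).condExp one_le_two)

lemma trace_meanRemoteErrCov (h : s.IsModel μ A C Q R Pbar lam lamE) (k : ℕ) :
    (s.meanRemoteErrCov μ A C π k).trace =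
      ∫ ω, ‖s.state A k ω - (μ[s.state A k | s.info μ A C π s.γ k]) ω‖ ^ 2 ∂μ := by
  have hle := h.info_le (π := π) s.measurable_channel_sigmaOn k
  have hi : ∀ i, MemLp (fun ω =>
      (s.state A k ω - (μ[s.state A k | s.info μ A C π s.γ k]) ω) i) 2 μ := fun i =>
    (h.memLp_remoteErr k).continuousLinearMap_comp (EuclideanSpace.proj i : Vec n →L[ℝ] ℝ)
  simp only [EuclideanSpace.norm_sq_eq, Real.norm_eq_abs, sq_abs]
  rw [integral_finsetSum _ fun i _ => (hi i).integrable_sq]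
  refine Finset.sum_congr rfl fun i _ => ?_
  refine Eq.trans (integral_condExp hle (f := fun ω =>
    (s.state A k ω - (μ[s.state A k | s.info μ A C π s.γ k]) ω) i *
      (s.state A k ω - (μ[s.state A k | s.info μ A C π s.γ k]) ω) i)) ?_
  exact integral_congr_ae (ae_of_all _ fun ω => (sq _).symm)

lemma trace_meanRemoteErrCov_nonneg (h : s.IsModel μ A C Q R Pbar lam lamE) (k : ℕ) :
    0 ≤ (s.meanRemoteErrCov μ A C π k).trace := by
  rw [h.trace_meanRemoteErrCov]
  exact integral_nonneg fun ω => sq_nonneg _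

omit [IsProbabilityMeasure μ] in
lemma measurable_lastTx (h : s.IsModel μ A C Q R Pbar lam lamE) (k : ℕ) :
    Measurable (s.lastTx π k) :=
  (s.measurable_lastTx_before π k).mono (h.sigmaOn_le _) le_rfl

lemma integrable_comp_lastTx (h : s.IsModel μ A C Q R Pbar lam lamE) (k : ℕ) (f : ℕ → ℝ) :
    Integrable (fun ω => f (s.lastTx π k ω)) μ := by
  have hm := h.measurable_lastTx (π := π) k
  refine integrable_of_fiber (s.lastTx_le π k) fun j _ => ?_
  exact ((integrable_const (f j)).integrableOn).congr_fun
    (fun ω (hω : s.lastTx π k ω = j) => by simp [hω]) (hm (measurableSet_singleton j))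

/-- The directional bounds for a and b are added, with Cauchy–Schwarz passing from directional
errors to the norm. The gap since the last reception is replaced by the smaller gap since the last
transmission. -/
lemma integral_sq_le_trace (h : s.IsModel μ A C Q R Pbar lam lamE) (hQ : Q.PosDef) {c : ℝ}
    (hc : 0 ≤ c) {a b : Vec n}
    (hab : ∀ t : ℕ, c * (t : ℝ) ^ 2 ≤ predVar A Q Pbar t a + predVar A Q Pbar t b) (k : ℕ) :
    c * ∫ ω, ((k : ℝ) - s.lastTx π k ω) ^ 2 ∂μ ≤
      (‖a‖ ^ 2 + ‖b‖ ^ 2) * (s.meanRemoteErrCov μ A C π k).trace := by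
  have hch := s.measurable_channel_sigmaOn
  have hN := (s.measurable_lastArrival_sigmaOn π hch k).mono (h.sigmaOn_le _) le_rfl
  have hV : ∀ t u, 0 ≤ predVar A Q Pbar t u := predVar_nonneg hQ h.quadForm_nonneg
  have hp : ∀ u, Measurable fun ω => predVar A Q Pbar (k - s.lastArrival π s.γ k ω) u :=
    fun u => (Measurable.of_discrete (f := fun j => predVar A Q Pbar (k - j) u)).comp hN
  set d : Ω → Vec n := fun ω => s.state A k ω - (μ[s.state A k | s.info μ A C π s.γ k]) ω with hd
  have hd2 : MemLp d 2 μ := h.memLp_remoteErr k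
  have hnorm : Integrable (fun ω => ‖d ω‖ ^ 2) μ := hd2.integrable_norm_pow two_ne_zero
  rw [h.trace_meanRemoteErrCov, ← integral_const_mul, ← integral_const_mul]
  have hdir : ∀ u : Vec n, ∫⁻ ω, ENNReal.ofReal (predVar A Q Pbar
      (k - s.lastArrival π s.γ k ω) u) ∂μ ≤ ∫⁻ ω, ENNReal.ofReal (‖u‖ ^ 2 * ‖d ω‖ ^ 2) ∂μ :=
    fun u => (h.lintegral_predVar_le hQ hch k u).trans (lintegral_mono fun ω => by
      refine ENNReal.ofReal_le_ofReal ?_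
      rw [← mul_pow, ← sq_abs]
      exact pow_le_pow_left₀ (abs_nonneg _) (abs_real_inner_le_norm _ _) 2)
  have hfin : ∫⁻ ω, ENNReal.ofReal (c * ((k : ℝ) - s.lastTx π k ω) ^ 2) ∂μ ≤
      ∫⁻ ω, ENNReal.ofReal ((‖a‖ ^ 2 + ‖b‖ ^ 2) * ‖d ω‖ ^ 2) ∂μ := by
    calc ∫⁻ ω, ENNReal.ofReal (c * ((k : ℝ) - s.lastTx π k ω) ^ 2) ∂μ
        ≤ ∫⁻ ω, (ENNReal.ofReal (predVar A Q Pbar (k - s.lastArrival π s.γ k ω) a) +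
            ENNReal.ofReal (predVar A Q Pbar (k - s.lastArrival π s.γ k ω) b)) ∂μ := by
          refine lintegral_mono fun ω => ?_
          rw [← ENNReal.ofReal_add (hV _ _) (hV _ _)]
          refine ENNReal.ofReal_le_ofReal (le_trans ?_ (hab _))
          refine mul_le_mul_of_nonneg_left ?_ hc
          rw [Nat.cast_sub (s.lastArrival_le π s.γ k ω)]
          have h1 : (s.lastArrival π s.γ k ω : ℝ) ≤ s.lastTx π k ω :=
            Nat.cast_le.2 (s.lastArrival_le_lastTx π s.γ k ω)
          have h2 : (s.lastTx π k ω : ℝ) ≤ k := Nat.cast_le.2 (s.lastTx_le π k ω)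
          exact pow_le_pow_left₀ (by linarith) (by linarith) 2
      _ = _ := lintegral_add_left (hp a).ennreal_ofReal _
      _ ≤ _ := add_le_add (hdir a) (hdir b)
      _ = ∫⁻ ω, ENNReal.ofReal (‖a‖ ^ 2 * ‖d ω‖ ^ 2 + ‖b‖ ^ 2 * ‖d ω‖ ^ 2) ∂μ := by
          rw [← lintegral_add_left' (hnorm.const_mul (‖a‖ ^ 2)).aemeasurable.ennreal_ofReal]
          exact lintegral_congr fun ω => (ENNReal.ofReal_add (by positivity) (by positivity)).symm
      _ = _ := by simp only [add_mul]
  rw [← ofReal_integral_eq_lintegral_ofReal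
      (h.integrable_comp_lastTx k fun j => c * ((k : ℝ) - j) ^ 2)
      (ae_of_all _ fun ω => by positivity),
    ← ofReal_integral_eq_lintegral_ofReal (hnorm.const_mul _)
      (ae_of_all _ fun ω => by positivity)] at hfin
  exact (ENNReal.ofReal_le_ofReal_iff (integral_nonneg fun ω => by positivity)).1 hfin

/-- The mean gap closed by the eavesdropper's reception is at least `lamE` times the mean gap
closed by the transmission. -/
lemma mul_integral_lastTx_sub_le (h : s.IsModel μ A C Q R Pbar lam lamE) (k : ℕ) :
    lamE * (∫ ω, (s.lastTx π (k + 1) ω : ℝ) ∂μ - ∫ ω, (s.lastTx π k ω : ℝ) ∂μ) ≤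
      ∫ ω, (if s.arrives π s.γe (k + 1) ω then
        ((k + 1 - s.lastArrival π s.γe k ω : ℕ) : ℝ) else 0) ∂μ := by
  let B : Set Ω := {ω | s.γe (k + 1) ω = true}
  have hB : MeasurableSet[s.sigma (.tap (k + 1))] B :=
    comap_measurable (s.γe (k + 1)) (measurableSet_singleton true)
  have hi := fun k => h.integrable_comp_lastTx (π := π) k (fun j => (j : ℝ))
  have hm : Measurable[s.sigmaOn (channelSourcesBefore (k + 1))]
      (fun ω => (s.lastTx π (k + 1) ω : ℝ) - s.lastTx π k ω) := by
    have h1 := s.measurable_lastTx_before π (k + 1)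
    have h2 := (s.measurable_lastTx_before π k).mono
      (s.sigmaOn_mono (channelSourcesBefore_mono k.le_succ)) le_rfl
    exact ((Measurable.of_discrete (f := fun j : ℕ => (j : ℝ))).comp h1).sub
      ((Measurable.of_discrete (f := fun j : ℕ => (j : ℝ))).comp h2)
  have hd : Disjoint (channelSourcesBefore (k + 1)) {.tap (k + 1)} := by
    simp [channelSourcesBefore]
  have hind := indep_of_indep_of_le_left (indep_of_indep_of_le_right (h.indep_sigmaOn hd)
    (s.sigma_le_sigmaOn (i := .tap (k + 1)) rfl)) hm.comap_le
  -- The increment of `lastTx` depends on outcomes before k + 1 only, so restricting to a success of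
  -- the tap at k + 1 multiplies its mean by `lamE`.
  have hset := setIntegral_of_indep (h.sigma_le (.tap (k + 1)))
    (hm.mono (h.sigmaOn_le _) le_rfl) hind hB
  have hBr : μ.real B = lamE := h.law_tap (k + 1)
  rw [hBr, integral_sub (hi (k + 1)) (hi k)] at hset
  rw [← hset, ← integral_indicator (h.sigma_le _ _ hB)]
  have harr := h.measurable_arrives (π := π) s.measurable_tap_sigmaOn (k + 1)
  have hN := (s.measurable_lastArrival_sigmaOn π s.measurable_tap_sigmaOn k).mono
    (h.sigmaOn_le _) le_rfl
  have hbd : Integrable (fun ω => (if s.arrives π s.γe (k + 1) ω then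
        ((k + 1 - s.lastArrival π s.γe k ω : ℕ) : ℝ) else 0)) μ := by
    refine Integrable.of_bound (C := (k + 1 : ℝ)) ?_ (ae_of_all _ fun ω => ?_)
    · refine (Measurable.ite (harr (measurableSet_singleton true)) ?_
        measurable_const).aestronglyMeasurable
      exact (Measurable.of_discrete (f := fun j : ℕ => ((k + 1 - j : ℕ) : ℝ))).comp hN
    · split_ifs
      · rw [Real.norm_of_nonneg (Nat.cast_nonneg _)]
        exact_mod_cast Nat.sub_le _ _
      · rw [norm_zero]
        positivity
  refine integral_mono (((hi (k + 1)).sub (hi k)).indicator (h.sigma_le _ _ hB)) hbd fun ω => ?_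
  by_cases hω : s.γe (k + 1) ω = true
  · have hmem : ω ∈ B := hω
    simp only [Set.indicator_of_mem hmem, arrives_succ, hω, Bool.and_true]
    by_cases ht : s.tx π (k + 1) ω = true
    · have h1 : s.lastTx π (k + 1) ω = k + 1 := by simp [lastTx, lastTrue, ht]
      have h2 : (s.lastArrival π s.γe k ω : ℝ) ≤ s.lastTx π k ω :=
        Nat.cast_le.2 (s.lastArrival_le_lastTx π s.γe k ω)
      rw [if_pos ht, h1, Nat.cast_sub ((s.lastArrival_le π s.γe k ω).trans k.le_succ)]
      linarith
    · have h1 : s.lastTx π (k + 1) ω = s.lastTx π k ω := by simp [lastTx, lastTrue, ht]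
      rw [if_neg ht, h1, sub_self]
  · have hmem : ω ∉ B := hω
    rw [Set.indicator_of_notMem hmem]
    split_ifs <;> positivity

/-- Lower bound on the total revealed information by the mean time of the last transmission. -/
lemma ofReal_le_sum_revealedInfo (h : s.IsModel μ A C Q R Pbar lam lamE) (hQ : Q.PosDef)
    {ρ : ℝ} (hρ : 1 < ρ)
    (hu : ∀ t, ∃ u : Vec n, ρ ^ (t + 1) * quadForm Pbar u < predVar A Q Pbar (t + 1) u) (K : ℕ) :
    ENNReal.ofReal (1 / 2 * Real.log ρ * lamE * ∫ ω, (s.lastTx π K ω : ℝ) ∂μ) ≤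
      ∑ k ∈ Finset.Icc 1 K, s.revealedInfo μ A C π k := by
  choose u hu using hu
  -- A gap is at least one, so the directions are shifted by one index and the value at gap zero is
  -- irrelevant.
  have hu' : ∀ t, 0 < t → ρ ^ t * quadForm Pbar (u (t - 1)) <
      predVar A Q Pbar t (u (t - 1)) := fun t ht => by
    have := hu (t - 1)
    rwa [Nat.sub_add_cancel ht] at this
  have hlog : 0 < Real.log ρ := Real.log_pos hρ
  induction K with
  | zero => simp [lastTx, lastTrue]
  | succ K ih =>
    rw [Finset.sum_Icc_succ_top (by omega)]
    have h1 := h.ofReal_le_condMutualInfo (π := π) hQ s.measurable_tap_sigmaOn hρ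
      (u := fun t => u (t - 1)) hu' K
    have h2 := mul_le_mul_of_nonneg_left (h.mul_integral_lastTx_sub_le (π := π) K)
      (a := 1 / 2 * Real.log ρ) (by positivity)
    refine le_trans ?_ (add_le_add ih ((ENNReal.ofReal_le_ofReal h2).trans h1))
    refine le_trans (ENNReal.ofReal_le_ofReal (le_of_eq ?_)) ENNReal.ofReal_add_le
    ring

end Primitives.IsModel

end RemoteEstimation

/-! ### From a bounded average error to a positive information rate. -/

theorem theorem5 {n : ℕ} (A Q Pbar : Matrix (Fin n) (Fin n) ℝ) (lamE : ℝ)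
    (hA : RemoteEstimation.IsUnstable A) (hQ : Q.PosDef) (hlamE : 0 < lamE) :
    ∃ ε : ℝ, 0 < ε ∧
      ∀ (m : ℕ) (C : Matrix (Fin m) (Fin n) ℝ) (R : Matrix (Fin m) (Fin m) ℝ) (lam : ℝ)
        (Ω : Type*) [MeasurableSpace Ω] (μ : Measure Ω) [IsProbabilityMeasure μ]
        (s : RemoteEstimation.Primitives n m Ω),
        R.PosDef → s.IsModel μ A C Q R Pbar lam lamE →
        ∀ π : RemoteEstimation.Policy,
          limsup (fun K : ℕ =>
              (((K : ℝ)⁻¹ * ∑ k ∈ Finset.Icc 1 K, (s.meanRemoteErrCov μ A C π k).trace : ℝ) :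
                EReal)) atTop < ⊤ →
          ENNReal.ofReal ε <
            liminf (fun K : ℕ =>
              (K : ENNReal)⁻¹ * ∑ k ∈ Finset.Icc 1 K, s.revealedInfo μ A C π k) atTop := by
  obtain ⟨α, β, a, b, hρ, hab, ha, hb⟩ := RemoteEstimation.exists_unstable_pair hA
  have hlog : 0 < Real.log (α ^ 2 + β ^ 2) := Real.log_pos hρ
  set κ : ℝ := 1 / 2 * Real.log (α ^ 2 + β ^ 2) * lamE with hκ
  have hκ0 : 0 < κ := by positivity
  -- The averages are eventually at least κ/2, because E[`lastTx` K] ≥ K/2; the smaller κ/4 makes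
  -- the inequality strict.
  refine ⟨κ / 4, by positivity, ?_⟩
  intro m C R lam Ω _ μ _ s _ h π hlim
  have hinfo := h.ofReal_le_sum_revealedInfo (π := π) hQ hρ
    (RemoteEstimation.exists_direction hQ hab ha hb)
  set c : ℝ := (RemoteEstimation.quadForm Q a + RemoteEstimation.quadForm Q b) *
    ((α ^ 2 + β ^ 2 - 1) / (α ^ 2 + β ^ 2))
  have hc : 0 < c := mul_pos (RemoteEstimation.quadForm_pair_pos hQ hab)
    (div_pos (by linarith) (by linarith))
  have hrem := fun k => h.integral_sq_le_trace (π := π) hQ hc.le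
    (RemoteEstimation.sq_le_predVar_pair hQ h.quadForm_nonneg hρ ha hb) k
  set D : ℝ := ‖a‖ ^ 2 + ‖b‖ ^ 2
  obtain ⟨B, hB, -⟩ := EReal.lt_iff_exists_real_btwn.1 hlim
  have hev := eventually_lt_of_limsup_lt hB
  have hmain : ∀ᶠ K : ℕ in atTop, ENNReal.ofReal (κ / 2) ≤
      (K : ENNReal)⁻¹ * ∑ k ∈ Finset.Icc 1 K, s.revealedInfo μ A C π k := by
    -- The threshold on K ensures D·B/c ≤ K/4, which turns the bound 3K/4 - D·B/c into K/2.
    filter_upwards [hev, eventually_ge_atTop 1,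
      eventually_ge_atTop ⌈4 * (D * B / c)⌉₊] with K hK hK1 hKB
    have hK0 : (0 : ℝ) < K := by exact_mod_cast hK1
    have hKB' : 4 * (D * B / c) ≤ K := Nat.ceil_le.1 hKB
    rw [EReal.coe_lt_coe_iff, inv_mul_lt_iff₀ hK0] at hK
    -- The traces are nonnegative, so the last one is at most their whole sum.
    have htr : (s.meanRemoteErrCov μ A C π K).trace ≤ K * B :=
      (Finset.single_le_sum (fun k _ => h.trace_meanRemoteErrCov_nonneg k)
        (Finset.mem_Icc.2 ⟨hK1, le_rfl⟩)).trans hK.le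
    have hi := fun f => h.integrable_comp_lastTx (π := π) K f
    have hsq : ∫ ω, ((K : ℝ) - s.lastTx π K ω) ^ 2 ∂μ ≤ K * (D * B / c) := by
      have h1 : c * ∫ ω, ((K : ℝ) - s.lastTx π K ω) ^ 2 ∂μ ≤ D * (K * B) :=
        (hrem K).trans (mul_le_mul_of_nonneg_left htr (by positivity))
      rw [← mul_div_assoc, le_div_iff₀ hc]
      linarith
    -- With g = K - `lastTx` K, the inequality (K/2 - g)² ≥ 0 gives g ≤ K/4 + g²/K, so the second
    -- moment controls the mean gap.
    have hlin : 3 / 4 * (K : ℝ) - (∫ ω, ((K : ℝ) - s.lastTx π K ω) ^ 2 ∂μ) / K ≤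
        ∫ ω, (s.lastTx π K ω : ℝ) ∂μ := by
      have hsqi := (hi fun j => ((K : ℝ) - j) ^ 2).div_const (K : ℝ)
      have h1 : ∫ ω, (3 / 4 * (K : ℝ) - ((K : ℝ) - s.lastTx π K ω) ^ 2 / K) ∂μ ≤
          ∫ ω, (s.lastTx π K ω : ℝ) ∂μ := by
        refine integral_mono ((integrable_const _).sub hsqi) (hi fun j => (j : ℝ)) fun ω => ?_
        simp only
        rw [sub_le_iff_le_add, ← sub_le_iff_le_add', le_div_iff₀ hK0]
        nlinarith [sq_nonneg ((K : ℝ) / 2 - ((K : ℝ) - s.lastTx π K ω))]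
      rw [integral_sub (integrable_const _) hsqi, integral_div] at h1
      simpa using h1
    have hdiv : (∫ ω, ((K : ℝ) - s.lastTx π K ω) ^ 2 ∂μ) / K ≤ D * B / c := by
      rw [div_le_iff₀ hK0]
      linarith
    have hhalf : (K : ℝ) / 2 ≤ ∫ ω, (s.lastTx π K ω : ℝ) ∂μ := by linarith
    have hKe : (K : ENNReal)⁻¹ = ENNReal.ofReal ((K : ℝ)⁻¹) := by
      rw [ENNReal.ofReal_inv_of_pos hK0, ENNReal.ofReal_natCast]
    rw [hKe]
    refine le_trans ?_ (mul_le_mul_right (hinfo K) _)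
    rw [← ENNReal.ofReal_mul (by positivity)]
    refine ENNReal.ofReal_le_ofReal ?_
    rw [inv_mul_eq_div, le_div_iff₀ hK0]
    nlinarith [mul_le_mul_of_nonneg_left hhalf hκ0.le]
  refine lt_of_lt_of_le ?_ (le_liminf_of_le (by isBoundedDefault) hmain)
  exact (ENNReal.ofReal_lt_ofReal_iff (by positivity)).2 (by linarith)
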